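/- Conventions. All Hilbert spaces are complex and finite-dimensional, and $f^\dagger$ is the adjoint. A dagger Frobenius algebra is a Hilbert space $A$ with an associative unital multiplication $m:A\otimes A\to A$, $u:\mathbb C\to A$, such that $\Delta:=m^\dagger$ satisfies $(m\otimes 1)(1\otimes\Delta)=\Delta m=(1\otimes m)(\Delta\otimes 1)$; put $\epsilon:=u^\dagger$. It is special if $m\Delta=1$, symmetric if $\epsilon m$ is invariant under the swap. It has cap $\epsilon m$ and cup $\Delta u$, and the transpose of $f:A\to B$ is the map $B\to A\otimes A\otimes B\to A\otimes B\otimes B\to A$ given by the cup of $A$, $f$, and the cap of $B$. A $*$-isomorphism $f:A\to B$ is a map preserving $m,u,\Delta,\epsilon$ whose adjoint is its transpose. For $H\neq 0$ with $n=\dim H$, the endomorphism algebra of $H$ is $H\otimes H^*$ with $m((v\otimes f)\otimes(w\otimes g))=\tfrac1{\sqrt n}f(w)\,v\otimes g$ and $u(1)=\sqrt n\sum_i e_i\otimes e_i^*$. A quantum graph $\Gamma$ is a special symmetric dagger Frobenius algebra $V_\Gamma$ with a self-adjoint map $\Gamma:V_\Gamma\to V_\Gamma$ that equals its own transpose and satisfies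 $m(\Gamma\otimes\Gamma)\Delta=\Gamma$ and $m(\Gamma\otimes 1)\Delta=1$. It is classical if $V_\Gamma$ is commutative. A finite simple graph is viewed as the quantum graph $\mathbb C^{V}$ (pointwise multiplication, orthonormal basis $|v\rangle$) with its reflexive adjacency matrix (ones on the diagonal). A quantum isomorphism $(H,P):\Gamma\to\Gamma'$ is a Hilbert space $H$ and a linear map $P:H\otimes V_\Gamma\to V_{\Gamma'}\otimes H$ that intertwines (as a crossing of the $H$-wire) $m,u,\Delta,\epsilon$ and the adjacency matrices of $\Gamma$ and $\Gamma'$, and whose adjoint is obtained from $P$ by bending both algebra wires with the cup of $V_\Gamma$ and the cap of $V_{\Gamma'}$. The composite of $(H,P):\Gamma\to\Gamma'$ and $(H',Q):\Gamma'\to\Gamma''$ is $(H'\otimes H,Q\circ P)$ with $Q\circ P=(Q\otimes 1_H)(1_{H'}\otimes P)$, and the dual $(H^*,\overline P):\Gamma'\to\Gamma$ is $P^\dagger$ with the two $H$-wires bent. An intertwiner $(H,P)\to(H',P')$ is a linear map $f:H\to H'$ with $P'(f\otimes 1)=(1\otimes f)P$. $\mathrm{QAut}(\Gamma)$ is the monoidal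 dagger category of quantum isomorphisms $\Gamma\to\Gamma$ and intertwiners. A dagger Frobenius monoid in $\mathrm{QAut}(\Gamma)$ is an object $(K,X)$ with a dagger Frobenius algebra structure on $K$ whose multiplication and unit are intertwiners. It is simple if this algebra is $*$-isomorphic to the endomorphism algebra of some Hilbert space $H\neq 0$. Theorem. Let $\Gamma$ be a finite classical graph with vertex set $V$, and let $X$ be a simple dagger Frobenius monoid in $\mathrm{QAut}(\Gamma)$, whose underlying algebra is identified with the endomorphism algebra $H\otimes H^*$ along a given $*$-isomorphism. For $v\in V$ let $X_{v,v}=(\langle v|\otimes 1)\,X\,(1\otimes|v\rangle):H\otimes H^*\to H\otimes H^*$ be the diagonal entries of the projective permutation matrix of $X$. There is a quantum graph $\Gamma_X$ associated to $X$, that is, one for which there exists a quantum isomorphism $(L,P):\Gamma_X\to\Gamma$ such that $X$ is $*$-isomorphic, as a Frobenius monoid in $\mathrm{QAut}(\Gamma)$, to $(L\otimes L^*,P\circ\overline P)$ with the endomorphism algebra of $L$; moreover $L=H$ can be taken. For every such $\Gamma_X$ and every orthonormal basis $(e_a)$ of $H$, $$\dim Z(V_{\Gamma_X})=\frac1{\dim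 H}\sum_{v\in V}\ \sum_{a,b,c,d}\langle e_a\otimes e_b^*,\,X_{v,v}(e_c\otimes e_d^*)\rangle\;\langle e_c\otimes e_a^*,\,X_{v,v}(e_d\otimes e_b^*)\rangle .$$ Moreover $\Gamma_X$ is classical if and only if $\dim Z(V_{\Gamma_X})=|V|$, equivalently if and only if the right-hand side equals $|V|$. -/

import Mathlib

open scoped TensorProduct

universe u v k w z i

namespace QGraph

noncomputable section

/-! ## The dual of a finite-dimensional Hilbert space -/

section Dual

variable (H : Type*) [NormedAddCommGroup H] [InnerProductSpace ℂ H] [FiniteDimensional ℂ H]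

/-- The Riesz map `v ↦ v* = ⟪v, ·⟫` from `H` to `H*`. -/
def riesz : H ≃ₗᵢ⋆[ℂ] StrongDual ℂ H :=
  haveI : CompleteSpace H := FiniteDimensional.complete ℂ H
  InnerProductSpace.toDual ℂ H

/-- The Hilbert space structure of the dual space `H*`, with `⟪v*, w*⟫ = ⟪w, v⟫`; the norm is the
operator norm of functionals. -/
instance instInnerDual : InnerProductSpace ℂ (StrongDual ℂ H) where
  inner f g := inner ℂ ((riesz H).symm g) ((riesz H).symm f)
  norm_sq_eq_re_inner f := by
    rw [← (riesz H).symm.norm_map f]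
    exact norm_sq_eq_re_inner _
  conj_inner_symm f g := inner_conj_symm _ _
  add_left f g h := by rw [map_add, inner_add_right]
  smul_left f g c := by rw [map_smulₛₗ, inner_smul_right]

/-- The cap `H* ⊗ H → ℂ`, `f ⊗ v ↦ f v`. -/
def capLeft : StrongDual ℂ H ⊗[ℂ] H →ₗ[ℂ] ℂ :=
  TensorProduct.lift
    (LinearMap.mk₂ ℂ (fun f v => f v) (by simp) (by simp) (by simp) (by simp))

/-- The cap `H ⊗ H* → ℂ`, `v ⊗ f ↦ f v`. -/
def capRight : H ⊗[ℂ] StrongDual ℂ H →ₗ[ℂ] ℂ :=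
  TensorProduct.lift
    (LinearMap.mk₂ ℂ (fun v f => f v) (by simp) (by simp) (by simp) (by simp))

/-- The cup `ℂ → H ⊗ H*`, `1 ↦ ∑ᵢ eᵢ ⊗ eᵢ*` (the identity of `H`), as the adjoint of the cap
`H ⊗ H* → ℂ`. -/
def cupRight : ℂ →ₗ[ℂ] H ⊗[ℂ] StrongDual ℂ H :=
  LinearMap.adjoint (𝕜 := ℂ) (E := H ⊗[ℂ] StrongDual ℂ H) (F := ℂ) (capRight H)

end Dual

/-! ## Dagger Frobenius algebras -/

/-- A multiplication map and a unit map on a vector space (no laws). -/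
structure MonoidData (A : Type*) [AddCommGroup A] [Module ℂ A] where
  mul : A ⊗[ℂ] A →ₗ[ℂ] A
  unit : ℂ →ₗ[ℂ] A

namespace MonoidData

section

variable {A : Type*} [NormedAddCommGroup A] [InnerProductSpace ℂ A] [FiniteDimensional ℂ A]
  (M : MonoidData A)

/-- The comultiplication, the adjoint of the multiplication. -/
def comul : A →ₗ[ℂ] A ⊗[ℂ] A := LinearMap.adjoint M.mul

/-- The counit, the adjoint of the unit. -/
def counit : A →ₗ[ℂ] ℂ := LinearMap.adjoint M.unit

/-- The cap `A ⊗ A → ℂ` of a dagger Frobenius algebra. -/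
def cap : A ⊗[ℂ] A →ₗ[ℂ] ℂ := M.counit ∘ₗ M.mul

/-- The cup `ℂ → A ⊗ A` of a dagger Frobenius algebra. -/
def cup : ℂ →ₗ[ℂ] A ⊗[ℂ] A := M.comul ∘ₗ M.unit

/-- A dagger Frobenius algebra: associativity, unitality and the Frobenius equations. -/
structure IsDaggerFrobenius : Prop where
  assoc : M.mul ∘ₗ M.mul.rTensor A =
    M.mul ∘ₗ M.mul.lTensor A ∘ₗ (TensorProduct.assoc ℂ A A A).toLinearMap
  unit_mul : M.mul ∘ₗ M.unit.rTensor A = (TensorProduct.lid ℂ A).toLinearMap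
  mul_unit : M.mul ∘ₗ M.unit.lTensor A = (TensorProduct.rid ℂ A).toLinearMap
  frobenius_left : M.mul.rTensor A ∘ₗ (TensorProduct.assoc ℂ A A A).symm.toLinearMap ∘ₗ
    M.comul.lTensor A = M.comul ∘ₗ M.mul
  frobenius_right : M.mul.lTensor A ∘ₗ (TensorProduct.assoc ℂ A A A).toLinearMap ∘ₗ
    M.comul.rTensor A = M.comul ∘ₗ M.mul

/-- Multiplication after comultiplication is the identity. -/
def IsSpecial : Prop := M.mul ∘ₗ M.comul = LinearMap.id

/-- Counit after multiplication is invariant under the swap. -/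
def IsSymmetric : Prop := M.cap ∘ₗ (TensorProduct.comm ℂ A A).toLinearMap = M.cap

/-- The multiplication is invariant under the swap. -/
def IsCommutative : Prop := M.mul ∘ₗ (TensorProduct.comm ℂ A A).toLinearMap = M.mul

/-- The centre of the algebra. -/
def center : Submodule ℂ A where
  carrier := {a | ∀ b, M.mul (a ⊗ₜ[ℂ] b) = M.mul (b ⊗ₜ[ℂ] a)}
  add_mem' {x y} hx hy b := by
    rw [TensorProduct.add_tmul, TensorProduct.tmul_add, map_add, map_add, hx b, hy b]
  zero_mem' b := by simp
  smul_mem' c {x} hx b := by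
    rw [← TensorProduct.smul_tmul', TensorProduct.tmul_smul, map_smul, map_smul, hx b]

end

section

variable {A B : Type*} [NormedAddCommGroup A] [InnerProductSpace ℂ A] [FiniteDimensional ℂ A]
  [NormedAddCommGroup B] [InnerProductSpace ℂ B] [FiniteDimensional ℂ B]
  (M : MonoidData A) (N : MonoidData B)

/-- The transpose `B → A` of `f : A → B` along the cup of `A` and the cap of `B`:
`B → A ⊗ A ⊗ B → A ⊗ B ⊗ B → A`, with `f` applied in the middle factor. -/
def transpose (f : A →ₗ[ℂ] B) : B →ₗ[ℂ] A :=
  (TensorProduct.rid ℂ A).toLinearMap ∘ₗ N.cap.lTensor A ∘ₗ (f.rTensor B).lTensor A ∘ₗ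
    (TensorProduct.assoc ℂ A A B).toLinearMap ∘ₗ M.cup.rTensor B ∘ₗ
    (TensorProduct.lid ℂ B).symm.toLinearMap

/-- A `*`-homomorphism of dagger Frobenius algebras. -/
structure IsStarHom (f : A →ₗ[ℂ] B) : Prop where
  map_mul : f ∘ₗ M.mul = N.mul ∘ₗ TensorProduct.map f f
  map_unit : f ∘ₗ M.unit = N.unit
  adjoint_eq : LinearMap.adjoint f = M.transpose N f

/-- A `*`-cohomomorphism of dagger Frobenius algebras. -/
structure IsStarCohom (f : A →ₗ[ℂ] B) : Prop where
  map_comul : N.comul ∘ₗ f = TensorProduct.map f f ∘ₗ M.comul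
  map_counit : N.counit ∘ₗ f = M.counit
  adjoint_eq : LinearMap.adjoint f = M.transpose N f

/-- A `*`-isomorphism: both a `*`-homomorphism and a `*`-cohomomorphism. -/
def IsStarIso (f : A →ₗ[ℂ] B) : Prop := M.IsStarHom N f ∧ M.IsStarCohom N f

end

end MonoidData

/-- The endomorphism algebra of `H` on `H ⊗ H*`, with `n = dim H`: the multiplication is
`(v ⊗ f) ⊗ (w ⊗ g) ↦ (1/√n) f(w) • v ⊗ g` and the unit is `1 ↦ √n ∑ᵢ eᵢ ⊗ eᵢ*`. -/
def endAlgebra (H : Type*) [NormedAddCommGroup H] [InnerProductSpace ℂ H]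
    [FiniteDimensional ℂ H] : MonoidData (H ⊗[ℂ] StrongDual ℂ H) where
  mul := ((1 / √(Module.finrank ℂ H : ℝ) : ℝ) : ℂ) •
    ((TensorProduct.lid ℂ (StrongDual ℂ H)).toLinearMap.lTensor H ∘ₗ
      ((capLeft H).rTensor (StrongDual ℂ H)).lTensor H ∘ₗ
      (TensorProduct.assoc ℂ (StrongDual ℂ H) H (StrongDual ℂ H)).symm.toLinearMap.lTensor H ∘ₗ
      (TensorProduct.assoc ℂ H (StrongDual ℂ H) (H ⊗[ℂ] StrongDual ℂ H)).toLinearMap)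
  unit := ((√(Module.finrank ℂ H : ℝ) : ℝ) : ℂ) • cupRight H

/-! ## Quantum graphs -/

/-- A quantum graph: a special symmetric dagger Frobenius algebra `V` with a self-adjoint quantum
adjacency matrix. For `V` commutative, the last three conditions say that the adjacency matrix
has idempotent entries, is a symmetric matrix, and has only ones on the diagonal. -/
structure QuantumGraph where
  V : Type*
  [normed : NormedAddCommGroup V]
  [inner : InnerProductSpace ℂ V]
  [finite : FiniteDimensional ℂ V]
  alg : MonoidData V
  frobenius : alg.IsDaggerFrobenius
  special : alg.IsSpecial
  symmetric : alg.IsSymmetric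
  adj : V →ₗ[ℂ] V
  adj_adjoint : LinearMap.adjoint adj = adj
  adj_idem : alg.mul ∘ₗ TensorProduct.map adj adj ∘ₗ alg.comul = adj
  adj_symm : alg.transpose alg adj = adj
  adj_refl : alg.mul ∘ₗ adj.rTensor V ∘ₗ alg.comul = LinearMap.id

attribute [instance] QuantumGraph.normed QuantumGraph.inner QuantumGraph.finite

/-- A quantum graph is classical if its algebra of vertices is commutative. -/
def QuantumGraph.IsClassical (Γ : QuantumGraph) : Prop := Γ.alg.IsCommutative

section Classical

variable (V : Type*) [Fintype V]

/-- The algebra `ℂ^V` of a finite set `V`, with pointwise multiplication; the standard basis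
vectors are its orthonormal copyable elements. -/
def setAlgebra : MonoidData (EuclideanSpace ℂ V) where
  mul := TensorProduct.lift (LinearMap.mk₂ ℂ (fun x y => WithLp.toLp 2 fun v => x v * y v)
    (fun x y z => by ext v; simp [add_mul]) (fun c x y => by ext v; simp [mul_assoc])
    (fun x y z => by ext v; simp [mul_add]) (fun c x y => by ext v; simp [mul_left_comm]))
  unit := LinearMap.toSpanSingleton ℂ _ (WithLp.toLp 2 fun _ => 1)

variable {V} [DecidableEq V]

open Classical in
/-- The reflexive adjacency matrix of a graph. -/
def adjacency (G : SimpleGraph V) : Matrix V V ℂ :=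
  Matrix.of fun v w => if v = w ∨ G.Adj v w then 1 else 0

set_option linter.unusedSectionVars false in
theorem setAlgebra_mul_single (v w : V) :
    (setAlgebra V).mul (EuclideanSpace.single v 1 ⊗ₜ EuclideanSpace.single w 1) =
      if v = w then EuclideanSpace.single v 1 else 0 := by
  ext u
  by_cases h : v = w
  · subst h
    by_cases hu : u = v <;> simp [setAlgebra, hu]
  · by_cases hu : u = v
    · subst hu; simp [setAlgebra, h]
    · simp [setAlgebra, h, hu]

theorem setAlgebra_comul_single (v : V) :
    (setAlgebra V).comul (EuclideanSpace.single v 1) =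
      EuclideanSpace.single v 1 ⊗ₜ EuclideanSpace.single v 1 := by
  refine (TensorProduct.ext_iff_inner_right (𝕜 := ℂ)).2 fun x y => ?_
  rw [MonoidData.comul, LinearMap.adjoint_inner_left, TensorProduct.inner_tmul]
  simp [setAlgebra, EuclideanSpace.inner_single_left]

theorem setAlgebra_unit_apply : (setAlgebra V).unit 1 = ∑ v, EuclideanSpace.single v 1 := by
  ext u
  simp [setAlgebra, Finset.sum_apply, Pi.single_apply]

theorem setAlgebra_counit_single (v : V) :
    (setAlgebra V).counit (EuclideanSpace.single v 1) = 1 := by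
  refine ext_inner_right ℂ fun x => ?_
  rw [MonoidData.counit, LinearMap.adjoint_inner_left]
  simp [setAlgebra, EuclideanSpace.inner_single_left]

theorem set_ext {B : Type*} [AddCommGroup B] [Module ℂ B] {f g : EuclideanSpace ℂ V →ₗ[ℂ] B}
    (h : ∀ v, f (EuclideanSpace.single v 1) = g (EuclideanSpace.single v 1)) : f = g :=
  (EuclideanSpace.basisFun V ℂ).toBasis.ext fun v => by simpa using h v

theorem set_ext₂ {B : Type*} [AddCommGroup B] [Module ℂ B]
    {f g : EuclideanSpace ℂ V ⊗[ℂ] EuclideanSpace ℂ V →ₗ[ℂ] B}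
    (h : ∀ v w, f (EuclideanSpace.single v 1 ⊗ₜ EuclideanSpace.single w 1) =
      g (EuclideanSpace.single v 1 ⊗ₜ EuclideanSpace.single w 1)) : f = g :=
  TensorProduct.ext (set_ext fun v => set_ext fun w => by simpa using h v w)

theorem setAlgebra_isDaggerFrobenius : (setAlgebra V).IsDaggerFrobenius where
  assoc := TensorProduct.ext (set_ext₂ fun u v => set_ext fun w => by
    by_cases h : u = v
    · by_cases h' : v = w <;> simp [setAlgebra_mul_single, h, h']
    · by_cases h' : v = w
      · simp [setAlgebra_mul_single, h', show u ≠ w from h' ▸ h]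
      · simp [setAlgebra_mul_single, h, h'])
  unit_mul := TensorProduct.ext' fun c x => by ext u; simp [setAlgebra]
  mul_unit := TensorProduct.ext' fun x c => by ext u; simp [setAlgebra, mul_comm]
  frobenius_left := set_ext₂ fun v w => by
    by_cases h : v = w <;>
      simp [setAlgebra_mul_single, setAlgebra_comul_single, h]
  frobenius_right := set_ext₂ fun v w => by
    by_cases h : v = w <;>
      simp [setAlgebra_mul_single, setAlgebra_comul_single, h]

theorem setAlgebra_isSpecial : (setAlgebra V).IsSpecial :=
  set_ext fun v => by simp [setAlgebra_mul_single, setAlgebra_comul_single]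

theorem setAlgebra_isCommutative : (setAlgebra V).IsCommutative :=
  set_ext₂ fun v w => by
    by_cases h : v = w
    · simp [h]
    · simp [setAlgebra_mul_single, h, Ne.symm h]

theorem setAlgebra_isSymmetric : (setAlgebra V).IsSymmetric := by
  rw [MonoidData.IsSymmetric, MonoidData.cap, LinearMap.comp_assoc,
    show _ ∘ₗ _ = _ from setAlgebra_isCommutative]

theorem setAlgebra_cup : (setAlgebra V).cup 1 =
    ∑ v, EuclideanSpace.single v 1 ⊗ₜ EuclideanSpace.single v 1 := by
  simp [MonoidData.cup, setAlgebra_unit_apply, setAlgebra_comul_single]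

theorem setAlgebra_cap_single (v w : V) :
    (setAlgebra V).cap (EuclideanSpace.single v 1 ⊗ₜ EuclideanSpace.single w 1) =
      if v = w then 1 else 0 := by
  by_cases h : v = w <;>
    simp [MonoidData.cap, setAlgebra_mul_single, setAlgebra_counit_single, h]

theorem adjacency_single (G : SimpleGraph V) (v : V) :
    Matrix.toEuclideanLin (adjacency G) (EuclideanSpace.single v 1) =
      ∑ w, adjacency G w v • EuclideanSpace.single w 1 := by
  ext u
  simp [Finset.sum_apply, Pi.single_apply]

set_option linter.unusedSectionVars false in
theorem adjacency_symm (G : SimpleGraph V) (v w : V) : adjacency G v w = adjacency G w v := by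
  have h : (v = w ∨ G.Adj v w) ↔ (w = v ∨ G.Adj w v) := by rw [eq_comm, G.adj_comm]
  by_cases hv : v = w ∨ G.Adj v w
  · simp [adjacency, hv, h.1 hv]
  · simp [adjacency, hv, mt h.2 hv]

/-- A finite graph as a quantum graph on the algebra of its set of vertices. -/
abbrev classicalGraph (G : SimpleGraph V) : QuantumGraph where
  V := EuclideanSpace ℂ V
  alg := setAlgebra V
  frobenius := setAlgebra_isDaggerFrobenius
  special := setAlgebra_isSpecial
  symmetric := setAlgebra_isSymmetric
  adj := Matrix.toEuclideanLin (adjacency G)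
  adj_adjoint := by
    rw [← Matrix.toEuclideanLin_conjTranspose_eq_adjoint]
    congr 1
    ext v w
    rw [Matrix.conjTranspose_apply, adjacency_symm]
    by_cases h : v = w ∨ G.Adj v w <;> simp [adjacency, h]
  adj_idem := set_ext fun v => by
    have h : ∀ u, adjacency G u v * adjacency G u v = adjacency G u v := fun u => by
      by_cases h : u = v ∨ G.Adj u v <;> simp [adjacency, h]
    simp only [LinearMap.comp_apply, setAlgebra_comul_single, TensorProduct.map_tmul,
      adjacency_single, TensorProduct.sum_tmul, TensorProduct.tmul_sum, map_sum,
      TensorProduct.tmul_smul, ← TensorProduct.smul_tmul', map_smul, setAlgebra_mul_single,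
      smul_ite, smul_zero, Finset.sum_ite_eq', Finset.mem_univ, if_true,
      smul_smul, h]
  adj_symm := set_ext fun v => by
    simp [MonoidData.transpose, setAlgebra_cup, adjacency_single, TensorProduct.sum_tmul,
      TensorProduct.tmul_sum, TensorProduct.tmul_smul, ← TensorProduct.smul_tmul',
      setAlgebra_cap_single, adjacency_symm G v]
  adj_refl := set_ext fun v => by
    have h : adjacency G v v = 1 := by simp [adjacency]
    simp [setAlgebra_comul_single, adjacency_single, TensorProduct.sum_tmul,
      ← TensorProduct.smul_tmul', setAlgebra_mul_single, h]

end Classical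

/-! ## Quantum isomorphisms -/

section Diagrams

variable {H K A B C D : Type*}
  [NormedAddCommGroup H] [InnerProductSpace ℂ H] [FiniteDimensional ℂ H]
  [NormedAddCommGroup K] [InnerProductSpace ℂ K] [FiniteDimensional ℂ K]
  [NormedAddCommGroup A] [InnerProductSpace ℂ A] [FiniteDimensional ℂ A]
  [NormedAddCommGroup B] [InnerProductSpace ℂ B] [FiniteDimensional ℂ B]
  [NormedAddCommGroup C] [InnerProductSpace ℂ C] [FiniteDimensional ℂ C]

/-- The wire `H` crosses two algebra wires, one after the other:
`H ⊗ (A ⊗ A) → (B ⊗ H) ⊗ A → B ⊗ (B ⊗ H) ≃ (B ⊗ B) ⊗ H`. -/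
def crossTwo (P : H ⊗[ℂ] A →ₗ[ℂ] B ⊗[ℂ] H) :
    H ⊗[ℂ] (A ⊗[ℂ] A) →ₗ[ℂ] (B ⊗[ℂ] B) ⊗[ℂ] H :=
  (TensorProduct.assoc ℂ B B H).symm.toLinearMap ∘ₗ P.lTensor B ∘ₗ
    (TensorProduct.assoc ℂ B H A).toLinearMap ∘ₗ P.rTensor A ∘ₗ
    (TensorProduct.assoc ℂ H A A).symm.toLinearMap

/-- The composite of `P : H ⊗ A → B ⊗ H` and `Q : K ⊗ B → C ⊗ K`, with carrier `K ⊗ H`: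
`(K ⊗ H) ⊗ A → (K ⊗ B) ⊗ H → C ⊗ (K ⊗ H)`. -/
def compCross (Q : K ⊗[ℂ] B →ₗ[ℂ] C ⊗[ℂ] K) (P : H ⊗[ℂ] A →ₗ[ℂ] B ⊗[ℂ] H) :
    (K ⊗[ℂ] H) ⊗[ℂ] A →ₗ[ℂ] C ⊗[ℂ] (K ⊗[ℂ] H) :=
  (TensorProduct.assoc ℂ C K H).toLinearMap ∘ₗ Q.rTensor H ∘ₗ
    (TensorProduct.assoc ℂ K B H).symm.toLinearMap ∘ₗ P.lTensor K ∘ₗ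
    (TensorProduct.assoc ℂ K H A).toLinearMap

/-- The dual `H* ⊗ B → A ⊗ H*` of `P : H ⊗ A → B ⊗ H`: the adjoint `B ⊗ H → H ⊗ A` with the
two `H`-wires bent, `H* ⊗ B → H* ⊗ ((B ⊗ H) ⊗ H*) → H* ⊗ ((H ⊗ A) ⊗ H*) → A ⊗ H*`. -/
def dualCross (P : H ⊗[ℂ] A →ₗ[ℂ] B ⊗[ℂ] H) :
    StrongDual ℂ H ⊗[ℂ] B →ₗ[ℂ] A ⊗[ℂ] StrongDual ℂ H :=
  (TensorProduct.lid ℂ (A ⊗[ℂ] StrongDual ℂ H)).toLinearMap ∘ₗ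
    (capLeft H).rTensor (A ⊗[ℂ] StrongDual ℂ H) ∘ₗ
    (TensorProduct.assoc ℂ (StrongDual ℂ H) H (A ⊗[ℂ] StrongDual ℂ H)).symm.toLinearMap ∘ₗ
    (TensorProduct.assoc ℂ H A (StrongDual ℂ H)).toLinearMap.lTensor (StrongDual ℂ H) ∘ₗ
    ((LinearMap.adjoint P).rTensor (StrongDual ℂ H)).lTensor (StrongDual ℂ H) ∘ₗ
    (TensorProduct.assoc ℂ B H (StrongDual ℂ H)).symm.toLinearMap.lTensor (StrongDual ℂ H) ∘ₗ
    (TensorProduct.assoc ℂ (StrongDual ℂ H) B (H ⊗[ℂ] StrongDual ℂ H)).toLinearMap ∘ₗ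
    (cupRight H).lTensor (StrongDual ℂ H ⊗[ℂ] B) ∘ₗ
    (TensorProduct.rid ℂ (StrongDual ℂ H ⊗[ℂ] B)).symm.toLinearMap

/-- The map `B ⊗ H → H ⊗ A` obtained from `P : H ⊗ A → B ⊗ H` by bending the two algebra wires
along the cup of `A` and the cap of `B`:
`B ⊗ H → B ⊗ ((H ⊗ A) ⊗ A) → B ⊗ ((B ⊗ H) ⊗ A) → H ⊗ A`. -/
def bendCross (M : MonoidData A) (N : MonoidData B) (P : H ⊗[ℂ] A →ₗ[ℂ] B ⊗[ℂ] H) :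
    B ⊗[ℂ] H →ₗ[ℂ] H ⊗[ℂ] A :=
  (TensorProduct.lid ℂ (H ⊗[ℂ] A)).toLinearMap ∘ₗ N.cap.rTensor (H ⊗[ℂ] A) ∘ₗ
    (TensorProduct.assoc ℂ B B (H ⊗[ℂ] A)).symm.toLinearMap ∘ₗ
    (TensorProduct.assoc ℂ B H A).toLinearMap.lTensor B ∘ₗ (P.rTensor A).lTensor B ∘ₗ
    (TensorProduct.assoc ℂ H A A).symm.toLinearMap.lTensor B ∘ₗ
    (TensorProduct.assoc ℂ B H (A ⊗[ℂ] A)).toLinearMap ∘ₗ M.cup.lTensor (B ⊗[ℂ] H) ∘ₗ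
    (TensorProduct.rid ℂ (B ⊗[ℂ] H)).symm.toLinearMap

/-- The intertwiner condition on `f : H → K` for `P : H ⊗ A → B ⊗ H` and `Q : K ⊗ A → B ⊗ K`. -/
def IsIntertwiner (P : H ⊗[ℂ] A →ₗ[ℂ] B ⊗[ℂ] H) (Q : K ⊗[ℂ] A →ₗ[ℂ] B ⊗[ℂ] K)
    (f : H →ₗ[ℂ] K) : Prop :=
  Q ∘ₗ f.rTensor A = f.lTensor B ∘ₗ P

/-- The monoidal unit, with carrier `ℂ`: the identity `ℂ ⊗ A ≃ A ≃ A ⊗ ℂ`. -/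
def unitCross (A : Type*) [NormedAddCommGroup A] [InnerProductSpace ℂ A] :
    ℂ ⊗[ℂ] A →ₗ[ℂ] A ⊗[ℂ] ℂ :=
  (TensorProduct.comm ℂ ℂ A).toLinearMap

end Diagrams

/-- A quantum isomorphism `(H, P) : Γ → Γ'`. -/
structure QuantumIso (Γ Γ' : QuantumGraph) (H : Type*) [NormedAddCommGroup H]
    [InnerProductSpace ℂ H] [FiniteDimensional ℂ H] where
  P : H ⊗[ℂ] Γ.V →ₗ[ℂ] Γ'.V ⊗[ℂ] H
  comul : Γ'.alg.comul.rTensor H ∘ₗ P = crossTwo P ∘ₗ Γ.alg.comul.lTensor H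
  counit : Γ'.alg.counit.rTensor H ∘ₗ P =
    (TensorProduct.comm ℂ H ℂ).toLinearMap ∘ₗ Γ.alg.counit.lTensor H
  adjoint_eq : LinearMap.adjoint P = bendCross Γ.alg Γ'.alg P
  mul : P ∘ₗ Γ.alg.mul.lTensor H = Γ'.alg.mul.rTensor H ∘ₗ crossTwo P
  unit : P ∘ₗ Γ.alg.unit.lTensor H =
    Γ'.alg.unit.rTensor H ∘ₗ (TensorProduct.comm ℂ H ℂ).toLinearMap
  adj : P ∘ₗ Γ.adj.lTensor H = Γ'.adj.rTensor H ∘ₗ P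

section Monoids

variable {Γ Γ' : QuantumGraph} {H K : Type*}
  [NormedAddCommGroup H] [InnerProductSpace ℂ H] [FiniteDimensional ℂ H]
  [NormedAddCommGroup K] [InnerProductSpace ℂ K] [FiniteDimensional ℂ K]

/-- A dagger Frobenius monoid in the monoidal dagger category `QAut(Γ)` of quantum automorphisms
of `Γ` and intertwiners, on the object `(K, X)`: a dagger Frobenius algebra on `K` whose
multiplication `(K, X) ⊗ (K, X) → (K, X)` and unit are intertwiners. -/
structure IsFrobeniusMonoid (X : QuantumIso Γ Γ K) (M : MonoidData K) : Prop where
  frobenius : M.IsDaggerFrobenius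
  mul_intertwiner : IsIntertwiner (compCross X.P X.P) X.P M.mul
  unit_intertwiner : IsIntertwiner (unitCross Γ.V) X.P M.unit

/-- The Frobenius monoid `(X, M)` in `QAut(Γ)` is `*`-isomorphic, in `QAut(Γ)`, to
`(H ⊗ H*, P ∘ P̄)` with the endomorphism algebra, for the quantum isomorphism `(H, P) : Γ' → Γ`. -/
def SplitsAs (X : QuantumIso Γ Γ K) (M : MonoidData K) (P : QuantumIso Γ' Γ H) : Prop :=
  ∃ g : K →ₗ[ℂ] H ⊗[ℂ] StrongDual ℂ H,
    MonoidData.IsStarIso (B := H ⊗[ℂ] StrongDual ℂ H) M (endAlgebra H) g ∧ IsIntertwiner X.P (compCross P.P (dualCross P.P)) g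

end Monoids

/-! ## The trace formula -/

section Formula

variable {V : Type*} [Fintype V] [DecidableEq V] {G : SimpleGraph V} {H K : Type*}
  [NormedAddCommGroup H] [InnerProductSpace ℂ H] [FiniteDimensional ℂ H]
  [NormedAddCommGroup K] [InnerProductSpace ℂ K] [FiniteDimensional ℂ K]

/-- The entry `X_{x,y} : K → K` of the projective permutation matrix of a quantum automorphism
`X` of a classical graph: `k ↦ (⟨y| ⊗ 1) X (k ⊗ |x⟩)`. -/
def entry (X : QuantumIso (classicalGraph G) (classicalGraph G) K) (x y : V) : K →ₗ[ℂ] K :=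
  (TensorProduct.lid ℂ K).toLinearMap ∘ₗ
    LinearMap.rTensor K (innerₛₗ ℂ (EuclideanSpace.single y (1 : ℂ) : EuclideanSpace ℂ V)) ∘ₗ
    X.P ∘ₗ (TensorProduct.mk ℂ K (EuclideanSpace ℂ V)).flip (EuclideanSpace.single x 1)

/-- The diagonal entry `X_{x,x}` as an operator on `H ⊗ H*`, along a unitary `f : K → H ⊗ H*`
(whose inverse is its adjoint). -/
def diagonal (X : QuantumIso (classicalGraph G) (classicalGraph G) K)
    (f : K →ₗ[ℂ] H ⊗[ℂ] StrongDual ℂ H) (x : V) :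
    H ⊗[ℂ] StrongDual ℂ H →ₗ[ℂ] H ⊗[ℂ] StrongDual ℂ H :=
  f ∘ₗ entry X x x ∘ₗ LinearMap.adjoint (𝕜 := ℂ) (E := K) (F := H ⊗[ℂ] StrongDual ℂ H) f

/-- The value of the closed tensor network with two nodes `S` and `T` on `H ⊗ H*` in which the
`H*`-output of `S` is joined to the `H*`-input of `T`, the `H`-outputs of `S` and the `H*`-output
of `T` are joined, the `H*`-input of `S` is joined to the `H`-input of `T`, and the `H`-input of
`S` is joined to the `H`-output of `T`, evaluated in an orthonormal basis `e` of `H`. -/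
def network {ι : Type*} [Fintype ι] (e : OrthonormalBasis ι ℂ H)
    (S T : H ⊗[ℂ] StrongDual ℂ H →ₗ[ℂ] H ⊗[ℂ] StrongDual ℂ H) : ℂ :=
  ∑ a, ∑ b, ∑ c, ∑ d,
    inner ℂ (e a ⊗ₜ[ℂ] riesz H (e b)) (S (e c ⊗ₜ[ℂ] riesz H (e d))) *
      inner ℂ (e c ⊗ₜ[ℂ] riesz H (e a)) (T (e d ⊗ₜ[ℂ] riesz H (e b)))

end Formula

end

end QGraph

/-! Everything is read off from matrix entries. A quantum isomorphism P from Γ to a classical graph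
amounts to maps P_x : V_Γ → End(L), one for each vertex x (`op`). The axioms make each P_x a unital
anti-homomorphism taking ♯ to the adjoint. For an orthonormal basis t of V_Γ, unitarity becomes Σ_x
P_x(a)† P_x(b) = ⟨a,b⟩·1 and Σ_j P_y(t_j) P_x(t_j)† = δ_xy·1. Under L ⊗ L* ≅ End(L), the entries of
P ∘ P̄ are k ↦ Σ_j P_y(t_j) k P_x(t_j)†.

Dimension formula: in a special symmetric dagger Frobenius algebra the average a ↦ Σ_j t_j a t_j♯ is
a projection onto the centre, so the centre has dimension Σ_ij ⟨t_i t_j, t_j t_i⟩. Multiplied by dim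
L, the first unitarity relation turns this into Σ_x Σ_ij tr(P_x(t_i) P_x(t_j) P_x(t_i)† P_x(t_j)†),
which is the network of the diagonal entries of P ∘ P̄ (`modelNetwork_sum`). The network also equals
dim H · tr((S ⊗ T) Δ m σ), σ the swap (`modelNetwork_eq_trace`); this sees only the Frobenius
algebra, so it may be computed along any `*`-isomorphism to an endomorphism algebra. Tracing both
unitarity relations gives dim V_Γ = |V|, so Γ is classical exactly when its centre has dimension
|V|.

Existence: transport the entries of X to operators Y_xy on End(H). Being a Frobenius monoid makes k
↦ (Y_xy(k)) a `*`-representation of the full matrix algebra End(H) on ℂ^V ⊗ H, hence a multiple of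
H: ℂ^V ⊗ H ≅ H ⊗ A. The multiplicity space A consists of the families (S_x) with S_y k = Σ_x Y_xy(k)
S_x. It is closed under pointwise products, adjoints and the adjacency matrix, and Schur's lemma
supplies its inner product, so it carries the quantum graph Γ_X. The isomorphism H ⊗ A → ℂ^V ⊗ H is
P, and the second unitarity relation returns Y_xy as the entries of P ∘ P̄. -/

namespace QGraph

noncomputable section

set_option linter.unusedSectionVars false

/-! ## Frobenius algebras by elements -/

namespace MonoidData

section Sharp

variable {A B : Type*} [NormedAddCommGroup A] [InnerProductSpace ℂ A] [FiniteDimensional ℂ A]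
  [NormedAddCommGroup B] [InnerProductSpace ℂ B] [FiniteDimensional ℂ B]
  (M : MonoidData A) (N : MonoidData B)

/-- The unit element. -/
def one : A := M.unit 1

/-- The element `a♯` with `⟪a♯, b⟫ = ε(b a)`. -/
def sharp (a : A) : A :=
  LinearMap.adjoint (M.mul ∘ₗ (TensorProduct.mk ℂ A A).flip a) M.one

theorem unit_apply (c : ℂ) : M.unit c = c • M.one := by
  rw [one, ← map_smul, smul_eq_mul, mul_one]

theorem counit_apply (a : A) : M.counit a = inner ℂ M.one a := by
  rw [one, counit, ← LinearMap.adjoint_inner_right]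
  simp

theorem inner_sharp (a b : A) :
    inner ℂ (M.sharp a) b = inner ℂ M.one (M.mul (b ⊗ₜ a)) := by
  rw [sharp, LinearMap.adjoint_inner_left]
  simp

theorem inner_comul (x : A ⊗[ℂ] A) (a : A) :
    inner ℂ x (M.comul a) = inner ℂ (M.mul x) a := by
  rw [comul, LinearMap.adjoint_inner_right]

theorem sharp_add (a b : A) : M.sharp (a + b) = M.sharp a + M.sharp b := by
  refine ext_inner_right ℂ fun c => ?_
  simp only [inner_add_left, inner_sharp, TensorProduct.tmul_add, map_add, inner_add_right]

theorem sharp_smul (c : ℂ) (a : A) : M.sharp (c • a) = starRingEnd ℂ c • M.sharp a := by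
  refine ext_inner_right ℂ fun b => ?_
  simp only [inner_smul_left, inner_sharp, TensorProduct.tmul_smul, map_smul, inner_smul_right,
    RingHomCompTriple.comp_apply, RingHom.id_apply]

/-- The map `♯` as a conjugate-linear map. -/
def sharpₗ : A →ₛₗ[starRingEnd ℂ] A where
  toFun := M.sharp
  map_add' := M.sharp_add
  map_smul' := M.sharp_smul

theorem sharp_sum {ι : Type*} (s : Finset ι) (a : ι → A) :
    M.sharp (∑ j ∈ s, a j) = ∑ j ∈ s, M.sharp (a j) :=
  map_sum M.sharpₗ a s

/-- The tool for evaluating maps defined as adjoints (comultiplication, cups, P†): pairing against a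
⊗ t_j suffices to expand a tensor along the second leg. -/
theorem tmul_sum_inner {ι : Type*} [Fintype ι] (t : OrthonormalBasis ι ℂ B) (x : A ⊗[ℂ] B)
    (φ : ι → A) (h : ∀ a j, inner ℂ (a ⊗ₜ[ℂ] t j) x = inner ℂ a (φ j)) :
    x = ∑ j, φ j ⊗ₜ[ℂ] t j := by
  refine (TensorProduct.ext_iff_inner_left (𝕜 := ℂ)).2 fun a b => ?_
  conv_lhs => rw [← t.sum_repr' b]
  simp only [TensorProduct.tmul_sum, TensorProduct.tmul_smul, sum_inner, inner_sum,
    inner_smul_left, h, inner_conj_symm, TensorProduct.inner_tmul]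
  exact Finset.sum_congr rfl fun j _ => mul_comm _ _

/-- An algebra in which right multiplication by `a♯` is adjoint to right multiplication by `a`. -/
structure IsRightFrobenius (M : MonoidData A) : Prop where
  assoc : ∀ a b c, M.mul (M.mul (a ⊗ₜ b) ⊗ₜ c) = M.mul (a ⊗ₜ M.mul (b ⊗ₜ c))
  one_mul : ∀ a, M.mul (M.one ⊗ₜ a) = a
  mul_one : ∀ a, M.mul (a ⊗ₜ M.one) = a
  inner_mul_right : ∀ a b c, inner ℂ (M.mul (b ⊗ₜ a)) c = inner ℂ b (M.mul (c ⊗ₜ M.sharp a))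

variable {M}

/-- Right multiplication by `a`. -/
def mulRight (M : MonoidData A) (a : A) : A →ₗ[ℂ] A := M.mul ∘ₗ (TensorProduct.mk ℂ A A).flip a

theorem IsDaggerFrobenius.isRightFrobenius (h : M.IsDaggerFrobenius) : M.IsRightFrobenius := by
  have assoc : ∀ a b c, M.mul (M.mul (a ⊗ₜ b) ⊗ₜ c) = M.mul (a ⊗ₜ M.mul (b ⊗ₜ c)) :=
    fun a b c => by simpa using LinearMap.congr_fun h.assoc ((a ⊗ₜ b) ⊗ₜ c)
  have one_mul : ∀ a, M.mul (M.one ⊗ₜ a) = a := fun a => by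
    simpa [one] using LinearMap.congr_fun h.unit_mul ((1 : ℂ) ⊗ₜ a)
  have mul_one : ∀ a, M.mul (a ⊗ₜ M.one) = a := fun a => by
    simpa [one] using LinearMap.congr_fun h.mul_unit (a ⊗ₜ (1 : ℂ))
  refine ⟨assoc, one_mul, mul_one, fun a b c => ?_⟩
  -- The Frobenius equation paired with x ⊗ d: the adjoint of right multiplication by a commutes
  -- with left multiplications. It is therefore right multiplication by its value at 1, which is a♯.
  have key : ∀ x d y : A, inner ℂ (M.mul (x ⊗ₜ d)) (M.mul (y ⊗ₜ a)) =
      inner ℂ (M.mul (x ⊗ₜ LinearMap.adjoint (M.mulRight a) d)) y := by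
    intro x d y
    have h2 := congrArg (inner ℂ (x ⊗ₜ[ℂ] d)) (LinearMap.congr_fun h.frobenius_right (y ⊗ₜ a))
    rw [LinearMap.comp_apply, LinearMap.comp_apply, LinearMap.comp_apply, inner_comul] at h2
    rw [← h2, ← inner_comul, LinearMap.rTensor_tmul]
    generalize M.comul y = u
    induction u with
    | zero => simp
    | add u z hy hz => simp only [inner_add_right, TensorProduct.add_tmul, map_add, hy, hz]
    | tmul u z => simp [TensorProduct.inner_tmul, LinearMap.adjoint_inner_left, mulRight]
  have h3 : LinearMap.adjoint (M.mulRight a) c = M.mul (c ⊗ₜ M.sharp a) := by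
    refine ext_inner_right ℂ fun y => ?_
    rw [sharp, ← mulRight, ← key, mul_one, LinearMap.adjoint_inner_left]
    simp [mulRight]
  rw [← h3, LinearMap.adjoint_inner_right]
  simp [mulRight]

/-- The cup of A contributes one ♯ and the cap of B the other, so no diagram is needed after this
point. -/
theorem transpose_apply (f : A →ₗ[ℂ] B) (b : B) :
    M.transpose N f b = M.sharp (LinearMap.adjoint f (N.sharp b)) := by
  refine ext_inner_left ℂ fun c => ?_
  have key : ∀ x : A ⊗[ℂ] A, inner ℂ c (TensorProduct.rid ℂ A (N.cap.lTensor A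
      ((f.rTensor B).lTensor A (TensorProduct.assoc ℂ A A B (x ⊗ₜ b))))) =
      inner ℂ (c ⊗ₜ[ℂ] LinearMap.adjoint f (N.sharp b)) x := by
    intro x
    induction x with
    | zero => simp
    | add u z hy hz => simp only [inner_add_right, TensorProduct.add_tmul, map_add, hy, hz]
    | tmul u z =>
      simp [TensorProduct.inner_tmul, LinearMap.adjoint_inner_left, cap, counit_apply, inner_sharp,
        mul_comm]
  rw [← inner_conj_symm c (M.sharp _), inner_sharp, inner_conj_symm, ← inner_comul, ← key]
  simp [transpose, cup, one]

namespace IsRightFrobenius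

variable (h : M.IsRightFrobenius)
include h

theorem sharp_sharp (a : A) : M.sharp (M.sharp a) = a := by
  refine ext_inner_right ℂ fun b => ?_
  rw [inner_sharp, ← h.inner_mul_right, h.one_mul]

theorem sharp_mul (a b : A) : M.sharp (M.mul (a ⊗ₜ b)) = M.mul (M.sharp b ⊗ₜ M.sharp a) := by
  refine ext_inner_right ℂ fun c => ?_
  rw [inner_sharp, h.inner_mul_right, h.sharp_sharp, inner_sharp, h.assoc]

theorem comul_apply {ι : Type*} [Fintype ι] (t : OrthonormalBasis ι ℂ A) (a : A) :
    M.comul a = ∑ j, M.mul (a ⊗ₜ M.sharp (t j)) ⊗ₜ[ℂ] t j :=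
  tmul_sum_inner t _ _ fun x j => by rw [inner_comul, h.inner_mul_right]

theorem comul_one {ι : Type*} [Fintype ι] (t : OrthonormalBasis ι ℂ A) :
    M.comul M.one = ∑ j, M.sharp (t j) ⊗ₜ[ℂ] t j := by
  simp only [h.comul_apply t, h.one_mul]

/-- By associativity mΔ is right multiplication by Σ_j t_j♯ t_j. -/
theorem isSpecial_iff {ι : Type*} [Fintype ι] (t : OrthonormalBasis ι ℂ A) :
    M.IsSpecial ↔ ∑ j, M.mul (M.sharp (t j) ⊗ₜ t j) = M.one := by
  have key : ∀ a, M.mul (M.comul a) = M.mul (a ⊗ₜ ∑ j, M.mul (M.sharp (t j) ⊗ₜ t j)) := fun a => by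
    simp only [h.comul_apply t, map_sum, h.assoc, TensorProduct.tmul_sum]
  constructor
  · intro hs
    have := LinearMap.congr_fun hs M.one
    rwa [LinearMap.comp_apply, key, h.one_mul, LinearMap.id_apply] at this
  · intro hs
    refine LinearMap.ext fun a => ?_
    rw [LinearMap.comp_apply, key, hs, h.mul_one, LinearMap.id_apply]

variable (hs : ∀ a b, inner ℂ M.one (M.mul (a ⊗ₜ b)) = inner ℂ M.one (M.mul (b ⊗ₜ a)))
include hs

theorem inner_mul_left (a b c : A) :
    inner ℂ (M.mul (a ⊗ₜ b)) c = inner ℂ b (M.mul (M.sharp a ⊗ₜ c)) := by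
  rw [h.inner_mul_right, ← h.one_mul a, h.inner_mul_right, h.one_mul, hs, ← h.assoc,
    ← h.inner_mul_right, h.one_mul]

/-- With a tracial counit, left multiplication by a also has adjoint left multiplication by a♯. Both
Frobenius equations then follow by moving a factor across the inner product. This certifies the
algebra built from operators later. -/
theorem isDaggerFrobenius : M.IsDaggerFrobenius where
  assoc := TensorProduct.ext_threefold fun a b c => by simp [h.assoc]
  unit_mul := TensorProduct.ext' fun c a => by
    simp [unit_apply, ← TensorProduct.smul_tmul', h.one_mul]
  mul_unit := TensorProduct.ext' fun a c => by simp [unit_apply, h.mul_one]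
  frobenius_left := TensorProduct.ext' fun a b => by
    refine (TensorProduct.ext_iff_inner_left (𝕜 := ℂ)).2 fun c d => ?_
    rw [LinearMap.comp_apply M.comul, inner_comul, h.inner_mul_left hs, ← h.assoc,
      ← h.sharp_sharp (M.mul (M.sharp c ⊗ₜ a)), ← h.inner_mul_left hs, h.sharp_mul,
      h.sharp_sharp, ← inner_comul]
    simp only [LinearMap.comp_apply, LinearMap.lTensor_tmul]
    generalize M.comul b = u
    induction u with
    | zero => simp
    | add u z hy hz => simp only [inner_add_right, TensorProduct.tmul_add, map_add, hy, hz]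
    | tmul u z => simp [TensorProduct.inner_tmul, h.inner_mul_left hs, h.sharp_sharp]
  frobenius_right := TensorProduct.ext' fun a b => by
    refine (TensorProduct.ext_iff_inner_left (𝕜 := ℂ)).2 fun c d => ?_
    rw [LinearMap.comp_apply M.comul, inner_comul, ← h.sharp_sharp b, ← h.inner_mul_right, h.assoc,
      ← inner_comul]
    simp only [LinearMap.comp_apply, LinearMap.rTensor_tmul]
    generalize M.comul a = u
    induction u with
    | zero => simp
    | add u z hy hz => simp only [inner_add_right, TensorProduct.add_tmul, map_add, hy, hz]
    | tmul u z => simp [TensorProduct.inner_tmul, h.inner_mul_right, h.sharp_sharp]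

omit h in
theorem isSymmetric : M.IsSymmetric :=
  TensorProduct.ext' fun a b => by simp [cap, counit_apply, hs a b]

/-- A tracial counit makes the cup invariant under the swap, so ♯ may sit on either leg. -/
theorem comul_one' {ι : Type*} [Fintype ι] (t : OrthonormalBasis ι ℂ A) :
    M.comul M.one = ∑ j, t j ⊗ₜ[ℂ] M.sharp (t j) := by
  have : M.comul M.one = TensorProduct.comm ℂ A A (M.comul M.one) := by
    refine (TensorProduct.ext_iff_inner_left (𝕜 := ℂ)).2 fun c d => ?_
    rw [inner_comul, ← TensorProduct.comm_tmul, TensorProduct.inner_comm_comm, inner_comul,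
      TensorProduct.comm_tmul, ← inner_conj_symm, hs, inner_conj_symm]
  rw [this, h.comul_one t]
  simp

end IsRightFrobenius

theorem IsSymmetric.inner_one (hs : M.IsSymmetric) (a b : A) :
    inner ℂ M.one (M.mul (a ⊗ₜ b)) = inner ℂ M.one (M.mul (b ⊗ₜ a)) := by
  simpa [cap, counit_apply] using LinearMap.congr_fun hs (b ⊗ₜ a)

/-- The dimension of the centre as a closed network. -/
theorem finrank_center (hF : M.IsDaggerFrobenius) (hsp : M.IsSpecial) (hsy : M.IsSymmetric)
    {ι : Type*} [Fintype ι] (t : OrthonormalBasis ι ℂ A) :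
    (Module.finrank ℂ M.center : ℂ) =
      ∑ i, ∑ j, inner ℂ (M.mul (t i ⊗ₜ t j)) (M.mul (t j ⊗ₜ t i)) := by
  have h := hF.isRightFrobenius
  -- The averaging map a ↦ Σ_j t_j a t_j♯; once it is a projection onto the centre, its trace is the
  -- dimension.
  let p : A →ₗ[ℂ] A := ∑ j, M.mulRight (M.sharp (t j)) ∘ₗ M.mul ∘ₗ TensorProduct.mk ℂ A A (t j)
  have hp : ∀ a, p a = ∑ j, M.mul (M.mul (t j ⊗ₜ a) ⊗ₜ M.sharp (t j)) := fun a => by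
    simp [p, mulRight]
  -- The two Frobenius equations identify both sides with Δ(b). Inserting a between the legs shows
  -- that p(a) is central.
  have key : ∀ b, ∑ j, M.mul (b ⊗ₜ t j) ⊗ₜ[ℂ] M.sharp (t j) =
      ∑ j, t j ⊗ₜ[ℂ] M.mul (M.sharp (t j) ⊗ₜ b) := fun b => by
    have h1 := LinearMap.congr_fun hF.frobenius_left (b ⊗ₜ M.one)
    have h2 := LinearMap.congr_fun hF.frobenius_right (M.one ⊗ₜ b)
    simp only [LinearMap.comp_apply, LinearMap.lTensor_tmul, LinearMap.rTensor_tmul, h.one_mul,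
      h.mul_one, h.comul_one' hsy.inner_one t, TensorProduct.tmul_sum, TensorProduct.sum_tmul,
      map_sum, LinearEquiv.coe_coe, TensorProduct.assoc_tmul,
      TensorProduct.assoc_symm_tmul] at h1 h2
    rw [h1, h2]
  have hproj : LinearMap.IsProj M.center p := by
    refine ⟨fun a b => ?_, fun a ha => ?_⟩
    · have := congrArg (M.mul ∘ₗ (M.mulRight a).rTensor A) (key b)
      simp only [map_sum, LinearMap.comp_apply, LinearMap.rTensor_tmul, mulRight,
        LinearMap.flip_apply, TensorProduct.mk_apply] at this
      rw [hp, TensorProduct.sum_tmul, TensorProduct.tmul_sum, map_sum, map_sum]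
      simpa only [h.assoc] using this.symm
    -- Specialness gives Σ_j t_j t_j♯ = 1, so p fixes central elements.
    · have h1 : M.mul (M.comul M.one) = M.one := LinearMap.congr_fun hsp M.one
      rw [h.comul_one' hsy.inner_one t, map_sum] at h1
      have ha' : ∀ b, M.mul (a ⊗ₜ b) = M.mul (b ⊗ₜ a) := ha
      rw [hp]
      conv_rhs => rw [← h.mul_one a, ← h1, TensorProduct.tmul_sum, map_sum]
      refine Finset.sum_congr rfl fun j _ => ?_
      rw [← ha', h.assoc]
  rw [← hproj.trace, LinearMap.trace_eq_sum_inner p t]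
  refine Finset.sum_congr rfl fun i _ => ?_
  rw [hp, inner_sum]
  refine Finset.sum_congr rfl fun j _ => ?_
  rw [h.inner_mul_right]

theorem isCommutative_iff_center : M.IsCommutative ↔ M.center = ⊤ := by
  rw [Submodule.eq_top_iff']
  constructor
  · intro hc a b
    simpa using LinearMap.congr_fun hc (b ⊗ₜ a)
  · intro hc
    refine TensorProduct.ext' fun a b => ?_
    simpa using hc b a

variable {N}

/-- A `*`-isomorphism is an isometry. -/
theorem IsStarIso.adjoint_comp (hM : M.IsRightFrobenius) {f : A →ₗ[ℂ] B} (hf : M.IsStarIso N f) :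
    LinearMap.adjoint f ∘ₗ f = LinearMap.id := by
  refine LinearMap.ext fun a => ?_
  rw [LinearMap.comp_apply, hf.1.adjoint_eq, transpose_apply, LinearMap.id_apply,
    ← hM.sharp_sharp a]
  congr 1
  -- What remains is f†((f a)♯) = a♯. Paired with c, it says that f preserves ε(c a), by
  -- multiplicativity and counitality.
  refine ext_inner_right ℂ fun c => ?_
  rw [LinearMap.adjoint_inner_left, inner_sharp, hM.sharp_sharp, inner_sharp]
  have h1 := LinearMap.congr_fun hf.1.map_mul (c ⊗ₜ a)
  have h2 := LinearMap.congr_fun hf.2.map_counit (M.mul (c ⊗ₜ a))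
  simp only [LinearMap.comp_apply, TensorProduct.map_tmul, counit_apply] at h1 h2
  rw [← h1, h2]

/-- A `*`-isomorphism is a coisometry. -/
theorem IsStarIso.comp_adjoint (hN : N.IsRightFrobenius)
    {f : A →ₗ[ℂ] B} (hf : M.IsStarIso N f) :
    f ∘ₗ LinearMap.adjoint f = LinearMap.id := by
  -- Compatibility with Δ, read through adjoints, makes f† multiplicative.
  have hmul : ∀ b c, LinearMap.adjoint f (N.mul (b ⊗ₜ c)) =
      M.mul (LinearMap.adjoint f b ⊗ₜ LinearMap.adjoint f c) := fun b c => by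
    have := congrArg LinearMap.adjoint hf.2.map_comul
    rw [LinearMap.adjoint_comp, LinearMap.adjoint_comp, comul, comul, LinearMap.adjoint_adjoint,
      LinearMap.adjoint_adjoint, TensorProduct.adjoint_map] at this
    simpa using LinearMap.congr_fun this (b ⊗ₜ c)
  have hone : f M.one = N.one := LinearMap.congr_fun hf.1.map_unit 1
  refine LinearMap.ext fun b => ?_
  refine ext_inner_right ℂ fun c => ?_
  rw [LinearMap.comp_apply, ← LinearMap.adjoint_inner_right, LinearMap.id_apply]
  nth_rw 1 [hf.1.adjoint_eq]
  rw [transpose_apply, inner_sharp, ← hmul, LinearMap.adjoint_inner_right, hone, ← inner_sharp,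
    hN.sharp_sharp]

end Sharp
end MonoidData

/-! ## Matrix entries of crossings with a set algebra -/

section Coordinates

variable {V : Type*} [Fintype V] [DecidableEq V] {H A : Type*}
  [NormedAddCommGroup H] [InnerProductSpace ℂ H] [FiniteDimensional ℂ H]
  [NormedAddCommGroup A] [InnerProductSpace ℂ A] [FiniteDimensional ℂ A]

/-- The coefficient `(⟨x| ⊗ 1) y` of a vector `y` of `ℂ^V ⊗ H`. -/
def coord (x : V) : EuclideanSpace ℂ V ⊗[ℂ] H →ₗ[ℂ] H :=
  (TensorProduct.lid ℂ H).toLinearMap ∘ₗ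
    LinearMap.rTensor H (innerₛₗ ℂ (EuclideanSpace.single x (1 : ℂ) : EuclideanSpace ℂ V))

@[simp]
theorem coord_tmul (x : V) (v : EuclideanSpace ℂ V) (h : H) :
    coord x (v ⊗ₜ[ℂ] h) = v x • h := by
  simp [coord, EuclideanSpace.inner_single_left]

theorem sum_single_tmul_coord (y : EuclideanSpace ℂ V ⊗[ℂ] H) :
    ∑ x, EuclideanSpace.single x (1 : ℂ) ⊗ₜ[ℂ] coord x y = y := by
  induction y with
  | zero => simp
  | add y z hy hz =>
    conv_rhs => rw [← hy, ← hz]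
    simp only [map_add, TensorProduct.tmul_add, Finset.sum_add_distrib]
  | tmul v h =>
    simp only [coord_tmul, TensorProduct.tmul_smul, TensorProduct.smul_tmul',
      ← TensorProduct.sum_tmul]
    congr 1
    ext u
    simp [Finset.sum_apply, Pi.single_apply]

theorem coord_ext {y z : EuclideanSpace ℂ V ⊗[ℂ] H} (h : ∀ x, coord x y = coord x z) : y = z := by
  rw [← sum_single_tmul_coord y, ← sum_single_tmul_coord z]
  simp only [h]

theorem inner_tmul_coord (v : EuclideanSpace ℂ V) (h : H) (y : EuclideanSpace ℂ V ⊗[ℂ] H) :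
    inner ℂ (v ⊗ₜ[ℂ] h) y = ∑ x, starRingEnd ℂ (v x) * inner ℂ h (coord x y) := by
  conv_lhs => rw [← sum_single_tmul_coord y]
  simp [inner_sum, TensorProduct.inner_tmul, EuclideanSpace.inner_single_right]

theorem inner_single_tmul (x : V) (h : H) (y : EuclideanSpace ℂ V ⊗[ℂ] H) :
    inner ℂ (EuclideanSpace.single x (1 : ℂ) ⊗ₜ[ℂ] h) y = inner ℂ h (coord x y) := by
  rw [inner_tmul_coord, Finset.sum_eq_single x] <;> simp +contextual

theorem inner_eq_sum_coord (y z : EuclideanSpace ℂ V ⊗[ℂ] H) :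
    inner ℂ y z = ∑ x, inner ℂ (coord x y) (coord x z) := by
  conv_lhs => rw [← sum_single_tmul_coord y]
  simp [sum_inner, inner_single_tmul]

/-- The matrix entries `H → H` of `P : H ⊗ A → ℂ^V ⊗ H`: `op P x a = (⟨x| ⊗ 1) P (· ⊗ a)`. -/
def op (P : H ⊗[ℂ] A →ₗ[ℂ] EuclideanSpace ℂ V ⊗[ℂ] H) (x : V) : A →ₗ[ℂ] H →ₗ[ℂ] H :=
  (TensorProduct.curry (coord x ∘ₗ P)).flip

theorem op_apply (P : H ⊗[ℂ] A →ₗ[ℂ] EuclideanSpace ℂ V ⊗[ℂ] H) (x : V) (a : A) (h : H) :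
    op P x a h = coord x (P (h ⊗ₜ a)) := rfl

theorem map_tmul_eq (P : H ⊗[ℂ] A →ₗ[ℂ] EuclideanSpace ℂ V ⊗[ℂ] H) (h : H) (a : A) :
    P (h ⊗ₜ a) = ∑ x, EuclideanSpace.single x (1 : ℂ) ⊗ₜ[ℂ] op P x a h :=
  (sum_single_tmul_coord _).symm

/-- The map `H ⊗ A → ℂ^V ⊗ H` with given matrix entries. -/
def ofOp (T : V → A →ₗ[ℂ] H →ₗ[ℂ] H) : H ⊗[ℂ] A →ₗ[ℂ] EuclideanSpace ℂ V ⊗[ℂ] H :=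
  ∑ x, TensorProduct.mk ℂ _ H (EuclideanSpace.single x (1 : ℂ)) ∘ₗ TensorProduct.lift (T x).flip

@[simp]
theorem op_ofOp (T : V → A →ₗ[ℂ] H →ₗ[ℂ] H) (x : V) : op (ofOp T) x = T x := by
  ext a h
  rw [op_apply, ofOp, LinearMap.sum_apply, map_sum, Finset.sum_eq_single x] <;>
    simp +contextual

variable (P : H ⊗[ℂ] A →ₗ[ℂ] EuclideanSpace ℂ V ⊗[ℂ] H)

theorem crossTwo_tmul (h : H) (a b : A) :
    crossTwo P (h ⊗ₜ (a ⊗ₜ b)) = ∑ x, ∑ y, (EuclideanSpace.single x (1 : ℂ) ⊗ₜ[ℂ]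
      EuclideanSpace.single y (1 : ℂ)) ⊗ₜ[ℂ] op P y b (op P x a h) := by
  simp [crossTwo, map_tmul_eq, TensorProduct.sum_tmul, TensorProduct.tmul_sum]

/-- Multiplication in ℂ^V keeps only equal labels x = y. The order is reversed because the `H`-wire
crosses a before b. -/
theorem mul_iff (M : MonoidData A) :
    P ∘ₗ M.mul.lTensor H = (setAlgebra V).mul.rTensor H ∘ₗ crossTwo P ↔
      ∀ x a b, op P x (M.mul (a ⊗ₜ b)) = op P x b ∘ₗ op P x a := by
  have key : ∀ x a b h, coord x ((setAlgebra V).mul.rTensor H (crossTwo P (h ⊗ₜ (a ⊗ₜ b)))) =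
      op P x b (op P x a h) := fun x a b h => by
    simp only [crossTwo_tmul, map_sum, LinearMap.rTensor_tmul, setAlgebra_mul_single]
    rw [Finset.sum_eq_single x, Finset.sum_eq_single x]
    · simp
    · intro y _ hy; simp [Ne.symm hy]
    · simp
    · intro y _ hy
      refine Finset.sum_eq_zero fun z _ => ?_
      by_cases hz : y = z <;> simp [hz]
      exact fun e => absurd (hz.trans e.symm) hy
    · simp
  constructor
  · intro h x a b
    ext l
    rw [LinearMap.comp_apply, ← key, op_apply]
    exact congrArg (coord x) (LinearMap.congr_fun h (l ⊗ₜ (a ⊗ₜ b)))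
  · intro h
    refine TensorProduct.ext (LinearMap.ext fun l => TensorProduct.ext' fun a b =>
      coord_ext fun x => ?_)
    have := LinearMap.congr_fun (h x a b) l
    rw [op_apply, LinearMap.comp_apply, ← key] at this
    exact this

theorem unit_iff (M : MonoidData A) :
    P ∘ₗ M.unit.lTensor H =
      (setAlgebra V).unit.rTensor H ∘ₗ (TensorProduct.comm ℂ H ℂ).toLinearMap ↔
      ∀ x, op P x M.one = LinearMap.id := by
  have key : ∀ (x : V) (h : H), coord x ((setAlgebra V).unit 1 ⊗ₜ[ℂ] h) = h := fun x h => by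
    rw [coord_tmul]; simp [setAlgebra]
  constructor
  · intro h x
    ext l
    simpa [key, ← op_apply, M.unit_apply] using
      congrArg (coord x) (LinearMap.congr_fun h (l ⊗ₜ (1 : ℂ)))
  · intro h
    refine TensorProduct.ext (LinearMap.ext fun l => LinearMap.ext_ring (coord_ext fun x => ?_))
    simp [key, ← op_apply, M.unit_apply, h]

theorem counit_iff (M : MonoidData A) :
    (setAlgebra V).counit.rTensor H ∘ₗ P =
      (TensorProduct.comm ℂ H ℂ).toLinearMap ∘ₗ M.counit.lTensor H ↔
      ∀ a, ∑ x, op P x a = inner ℂ M.one a • LinearMap.id := by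
  have key : ∀ a h, (setAlgebra V).counit.rTensor H (P (h ⊗ₜ a)) =
      (1 : ℂ) ⊗ₜ[ℂ] (∑ x, op P x a) h := fun a h => by
    simp [map_tmul_eq, setAlgebra_counit_single, TensorProduct.tmul_sum]
  constructor
  · intro h a
    ext l
    have := congrArg (TensorProduct.lid ℂ H) (LinearMap.congr_fun h (l ⊗ₜ a))
    rw [LinearMap.comp_apply, key] at this
    simpa [M.counit_apply] using this
  · intro h
    refine TensorProduct.ext' fun l a => ?_
    rw [LinearMap.comp_apply, key, h]
    simp [M.counit_apply, TensorProduct.smul_tmul']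

theorem adj_iff (Γ : A →ₗ[ℂ] A) (G : SimpleGraph V) :
    P ∘ₗ Γ.lTensor H = (Matrix.toEuclideanLin (adjacency G)).rTensor H ∘ₗ P ↔
      ∀ x a, op P x (Γ a) = ∑ y, adjacency G x y • op P y a := by
  have key : ∀ x a h, coord x ((Matrix.toEuclideanLin (adjacency G)).rTensor H (P (h ⊗ₜ a))) =
      (∑ y, adjacency G x y • op P y a) h := fun x a h => by
    simp [map_tmul_eq, LinearMap.sum_apply]
  constructor
  · intro h x a
    ext l
    rw [← key, op_apply]
    exact congrArg (coord x) (LinearMap.congr_fun h (l ⊗ₜ a))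
  · intro h
    refine TensorProduct.ext' fun l a => coord_ext fun x => ?_
    rw [LinearMap.comp_apply (LinearMap.rTensor _ _), key, ← h, op_apply]
    rfl

/-- Comparison of the coefficients of |x⟩ ⊗ |y⟩: ℂ^V copies its basis vectors, which yields the
Kronecker delta, while Δ(a) = Σ_j a t_j♯ ⊗ t_j yields the sum. -/
theorem comul_iff {M : MonoidData A} (hM : M.IsRightFrobenius) {ι : Type*} [Fintype ι]
    (t : OrthonormalBasis ι ℂ A) :
    (setAlgebra V).comul.rTensor H ∘ₗ P = crossTwo P ∘ₗ M.comul.lTensor H ↔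
      ∀ x y a, ∑ j, op P y (t j) ∘ₗ op P x (M.mul (a ⊗ₜ M.sharp (t j))) =
        if x = y then op P x a else 0 := by
  let c : V → V → (EuclideanSpace ℂ V ⊗[ℂ] EuclideanSpace ℂ V) ⊗[ℂ] H →ₗ[ℂ] H := fun x y =>
    coord y ∘ₗ coord x ∘ₗ (TensorProduct.assoc ℂ _ _ _).toLinearMap
  have hc : ∀ x y z w h, c x y ((EuclideanSpace.single z (1 : ℂ) ⊗ₜ[ℂ]
      EuclideanSpace.single w (1 : ℂ)) ⊗ₜ[ℂ] h) = if z = x then if w = y then h else 0 else 0 := by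
    intro x y z w h
    by_cases hz : x = z
    · simp [c, hz, eq_comm]
    · simp [c, hz, eq_comm]
  have hext : ∀ u v, (∀ x y, c x y u = c x y v) → u = v := fun u v h =>
    (TensorProduct.assoc ℂ _ _ _).injective (coord_ext fun x => coord_ext fun y => h x y)
  have h1 : ∀ x y a h, c x y ((setAlgebra V).comul.rTensor H (P (h ⊗ₜ a))) =
      (if x = y then op P x a else 0) h := fun x y a h => by
    simp only [map_tmul_eq, map_sum, LinearMap.rTensor_tmul, setAlgebra_comul_single, hc,
      Finset.sum_ite_eq', Finset.mem_univ, if_true]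
    split <;> rfl
  have h2 : ∀ x y a b h, c x y (crossTwo P (h ⊗ₜ (a ⊗ₜ b))) = op P y b (op P x a h) := by
    intro x y a b h
    simp [crossTwo_tmul, map_sum, hc]
  have h3 : ∀ x y a h, c x y (crossTwo P (h ⊗ₜ M.comul a)) =
      (∑ j, op P y (t j) ∘ₗ op P x (M.mul (a ⊗ₜ M.sharp (t j)))) h := fun x y a h => by
    simp only [hM.comul_apply t, TensorProduct.tmul_sum, map_sum, h2, LinearMap.sum_apply,
      LinearMap.comp_apply]
  constructor
  · intro h x y a
    ext l
    rw [← h1, ← h3]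
    exact congrArg (c x y) (LinearMap.congr_fun h (l ⊗ₜ a)).symm
  · intro h
    refine TensorProduct.ext' fun l a => hext _ _ fun x y => ?_
    rw [LinearMap.comp_apply (LinearMap.rTensor _ _), h1, ← h, ← h3]
    rfl

theorem inner_adjoint_single (x : V) (h l : H) (a : A) :
    inner ℂ (l ⊗ₜ[ℂ] a) (LinearMap.adjoint P (EuclideanSpace.single x (1 : ℂ) ⊗ₜ[ℂ] h)) =
      inner ℂ (op P x a l) h := by
  rw [LinearMap.adjoint_inner_right, ← inner_conj_symm, inner_single_tmul, inner_conj_symm,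
    op_apply]

theorem adjoint_single {ι : Type*} [Fintype ι] (t : OrthonormalBasis ι ℂ A) (x : V) (h : H) :
    LinearMap.adjoint P (EuclideanSpace.single x (1 : ℂ) ⊗ₜ[ℂ] h) =
      ∑ j, LinearMap.adjoint (op P x (t j)) h ⊗ₜ[ℂ] t j :=
  MonoidData.tmul_sum_inner t _ _ fun l j => by
    rw [inner_adjoint_single, LinearMap.adjoint_inner_right]

theorem bendCross_single {M : MonoidData A} (hM : M.IsRightFrobenius) {ι : Type*} [Fintype ι]
    (t : OrthonormalBasis ι ℂ A) (x : V) (h : H) :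
    bendCross M (setAlgebra V) P (EuclideanSpace.single x (1 : ℂ) ⊗ₜ[ℂ] h) =
      ∑ j, op P x (M.sharp (t j)) h ⊗ₜ[ℂ] t j := by
  have hc : M.cup 1 = ∑ j, M.sharp (t j) ⊗ₜ[ℂ] t j := hM.comul_one t
  simp only [bendCross, LinearMap.comp_apply, LinearEquiv.coe_coe, TensorProduct.rid_symm_apply,
    LinearMap.lTensor_tmul, LinearMap.rTensor_tmul, hc, TensorProduct.tmul_sum, map_sum,
    TensorProduct.assoc_tmul, TensorProduct.assoc_symm_tmul, map_tmul_eq, TensorProduct.sum_tmul,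
    setAlgebra_cap_single, TensorProduct.lid_tmul, ite_smul, one_smul, zero_smul,
    Finset.sum_ite_eq, Finset.mem_univ, if_true]

/-- On |x⟩ ⊗ h, P† has coefficients P_x(t_j)† h along t_j, and the bent map has P_x(t_j♯) h. -/
theorem adjoint_iff {M : MonoidData A} (hM : M.IsRightFrobenius) :
    LinearMap.adjoint P = bendCross M (setAlgebra V) P ↔
      ∀ x a, LinearMap.adjoint (op P x a) = op P x (M.sharp a) := by
  let t := stdOrthonormalBasis ℂ A
  constructor
  · intro h x a
    ext l
    refine ext_inner_left ℂ fun m => ?_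
    rw [LinearMap.adjoint_inner_right, ← inner_adjoint_single, h, bendCross_single P hM t]
    conv_rhs => rw [← t.sum_repr' a]
    simp [inner_sum, M.sharp_sum, M.sharp_smul, TensorProduct.inner_tmul, inner_smul_right,
      mul_comm, LinearMap.sum_apply]
  · intro h
    refine TensorProduct.ext (set_ext fun x => LinearMap.ext fun l => ?_)
    simp only [LinearMap.compr₂ₛₗ_apply, TensorProduct.mk_apply]
    rw [adjoint_single P t, bendCross_single P hM t]
    simp only [h]

end Coordinates

/-! ## Quantum isomorphisms to a classical graph -/

section DualBasis

variable {H : Type*} [NormedAddCommGroup H] [InnerProductSpace ℂ H] [FiniteDimensional ℂ H]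

theorem riesz_apply (v w : H) : riesz H v w = inner ℂ v w := rfl

theorem inner_riesz (v w : H) : inner ℂ (riesz H v) (riesz H w) = inner ℂ w v := by
  change inner ℂ ((riesz H).symm (riesz H w)) ((riesz H).symm (riesz H v)) = _
  rw [LinearIsometryEquiv.symm_apply_apply, LinearIsometryEquiv.symm_apply_apply]

theorem inner_riesz_left (v : H) (φ : StrongDual ℂ H) : inner ℂ (riesz H v) φ = φ v := by
  obtain ⟨w, rfl⟩ := (riesz H).surjective φ
  rw [inner_riesz, riesz_apply]

/-- The dual of an orthonormal basis. -/
def dualBasis {ι : Type*} [Fintype ι] (e : OrthonormalBasis ι ℂ H) :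
    OrthonormalBasis ι ℂ (StrongDual ℂ H) :=
  OrthonormalBasis.mk (v := fun i => riesz H (e i))
    (by
      classical
      rw [orthonormal_iff_ite]
      intro i j
      rw [inner_riesz, orthonormal_iff_ite.1 e.orthonormal j i]
      simp [eq_comm])
    (by
      intro φ _
      have : φ = ∑ i, φ (e i) • riesz H (e i) := by
        ext v
        conv_lhs => rw [← e.sum_repr' v]
        simp [riesz_apply, mul_comm]
      rw [this]
      exact Submodule.sum_mem _ fun i _ => Submodule.smul_mem _ _ (Submodule.subset_span ⟨i, rfl⟩))

@[simp]
theorem dualBasis_apply {ι : Type*} [Fintype ι] (e : OrthonormalBasis ι ℂ H) (i : ι) :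
    dualBasis e i = riesz H (e i) := by
  simp [dualBasis]

theorem cupRight_one {ι : Type*} [Fintype ι] (e : OrthonormalBasis ι ℂ H) :
    cupRight H 1 = ∑ i, e i ⊗ₜ[ℂ] riesz H (e i) := by
  rw [MonoidData.tmul_sum_inner (dualBasis e) (cupRight H 1) e fun a j => ?_]
  · simp
  · rw [cupRight, LinearMap.adjoint_inner_right]
    simp [capRight, riesz_apply]

/-- Precomposition with an endomorphism, on functionals. -/
def precomp (f : H →ₗ[ℂ] H) : StrongDual ℂ H →ₗ[ℂ] StrongDual ℂ H where
  toFun φ := φ ∘L LinearMap.toContinuousLinearMap f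
  map_add' _ _ := rfl
  map_smul' _ _ := rfl

@[simp]
theorem precomp_apply (f : H →ₗ[ℂ] H) (φ : StrongDual ℂ H) (v : H) : precomp f φ v = φ (f v) := rfl

variable {V : Type*} [Fintype V] [DecidableEq V] {A : Type*}
  [NormedAddCommGroup A] [InnerProductSpace ℂ A] [FiniteDimensional ℂ A]
  (P : H ⊗[ℂ] A →ₗ[ℂ] EuclideanSpace ℂ V ⊗[ℂ] H)

theorem dualCross_single {ι : Type*} [Fintype ι] (t : OrthonormalBasis ι ℂ A) (x : V)
    (φ : StrongDual ℂ H) :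
    dualCross P (φ ⊗ₜ EuclideanSpace.single x (1 : ℂ)) =
      ∑ j, t j ⊗ₜ[ℂ] precomp (LinearMap.adjoint (op P x (t j))) φ := by
  let e := stdOrthonormalBasis ℂ H
  simp only [dualCross, LinearMap.comp_apply, LinearEquiv.coe_coe, TensorProduct.rid_symm_apply,
    LinearMap.lTensor_tmul, LinearMap.rTensor_tmul, cupRight_one e, TensorProduct.tmul_sum, map_sum,
    TensorProduct.assoc_tmul, TensorProduct.assoc_symm_tmul, adjoint_single P t,
    TensorProduct.sum_tmul, TensorProduct.lid_tmul, capLeft, TensorProduct.lift.tmul,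
    LinearMap.mk₂_apply]
  rw [Finset.sum_comm]
  refine Finset.sum_congr rfl fun j _ => ?_
  simp only [← TensorProduct.tmul_smul, ← TensorProduct.tmul_sum]
  congr 1
  ext v
  conv_rhs => rw [← e.sum_repr' v]
  simp [riesz_apply, mul_comm]

/-- The inner `A`-wire of P ∘ P̄ is resolved by a basis; read on operators, the entry is k ↦ Σ_j
P_y(t_j) k P_x(t_j)†. -/
theorem coord_compCross_dualCross {ι : Type*} [Fintype ι] (t : OrthonormalBasis ι ℂ A) (x y : V)
    (k : H ⊗[ℂ] StrongDual ℂ H) :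
    coord y (compCross P (dualCross P) (k ⊗ₜ EuclideanSpace.single x (1 : ℂ))) =
      ∑ j, TensorProduct.map (op P y (t j)) (precomp (LinearMap.adjoint (op P x (t j)))) k := by
  induction k with
  | zero => simp
  | add k l hk hl => simp only [TensorProduct.add_tmul, map_add, hk, hl, Finset.sum_add_distrib]
  | tmul h φ =>
    simp only [compCross, LinearMap.comp_apply, LinearEquiv.coe_coe, TensorProduct.assoc_tmul,
      LinearMap.lTensor_tmul, dualCross_single P t, TensorProduct.tmul_sum, map_sum,
      TensorProduct.assoc_symm_tmul, LinearMap.rTensor_tmul, map_tmul_eq, TensorProduct.sum_tmul,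
      coord_tmul, TensorProduct.map_tmul]
    refine Finset.sum_congr rfl fun j _ => ?_
    rw [Finset.sum_eq_single y] <;> simp +contextual

end DualBasis

/-! ### Unitarity of the entries, and counting dimensions by traces -/

section Consequences

variable {V : Type*} [Fintype V] [DecidableEq V] {G : SimpleGraph V} {Γ : QuantumGraph} {L : Type*}
  [NormedAddCommGroup L] [InnerProductSpace ℂ L] [FiniteDimensional ℂ L]
  (P : QuantumIso Γ (classicalGraph G) L)

namespace QuantumIso

theorem op_mul (x : V) (a b : Γ.V) : op P.P x (Γ.alg.mul (a ⊗ₜ b)) = op P.P x b ∘ₗ op P.P x a :=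
  (mul_iff P.P Γ.alg).1 P.mul x a b

theorem op_one (x : V) : op P.P x Γ.alg.one = LinearMap.id :=
  (unit_iff P.P Γ.alg).1 P.unit x

theorem sum_op (a : Γ.V) : ∑ x, op P.P x a = inner ℂ Γ.alg.one a • LinearMap.id :=
  (counit_iff P.P Γ.alg).1 P.counit a

theorem op_adj (x : V) (a : Γ.V) : op P.P x (Γ.adj a) = ∑ y, adjacency G x y • op P.P y a :=
  (adj_iff P.P Γ.adj G).1 P.adj x a

theorem op_comul {ι : Type*} [Fintype ι] (t : OrthonormalBasis ι ℂ Γ.V) (x y : V) (a : Γ.V) :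
    ∑ j, op P.P y (t j) ∘ₗ op P.P x (Γ.alg.mul (a ⊗ₜ Γ.alg.sharp (t j))) =
      if x = y then op P.P x a else 0 :=
  (comul_iff P.P Γ.frobenius.isRightFrobenius t).1 P.comul x y a

theorem adjoint_op (x : V) (a : Γ.V) :
    LinearMap.adjoint (op P.P x a) = op P.P x (Γ.alg.sharp a) :=
  (adjoint_iff P.P Γ.frobenius.isRightFrobenius).1 P.adjoint_eq x a

/-- P†P = 1 in entries: the summand is P_x(b a♯), and summing over x gives ε(b a♯) = ⟨a,b⟩. -/
theorem sum_adjoint_op_comp (a b : Γ.V) :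
    ∑ x, LinearMap.adjoint (op P.P x a) ∘ₗ op P.P x b = inner ℂ a b • LinearMap.id := by
  have h := Γ.frobenius.isRightFrobenius
  simp only [adjoint_op, ← op_mul, sum_op]
  rw [← h.inner_mul_right, h.one_mul]

/-- PP† = 1 in entries: compatibility with the comultiplication, evaluated at the unit. -/
theorem sum_op_comp_adjoint {ι : Type*} [Fintype ι] (t : OrthonormalBasis ι ℂ Γ.V) (x y : V) :
    ∑ j, op P.P y (t j) ∘ₗ LinearMap.adjoint (op P.P x (t j)) =
      if x = y then LinearMap.id else 0 := by
  have h := Γ.frobenius.isRightFrobenius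
  have := P.op_comul t x y Γ.alg.one
  simpa only [h.one_mul, adjoint_op, op_one] using this

/-- By cyclicity the traces of the two unitarity relations agree, so dim V_Γ · dim L = |V| · dim L;
cancelling needs L ≠ 0. -/
theorem finrank_eq_card [Nontrivial L] (P : QuantumIso Γ (classicalGraph G) L) :
    Module.finrank ℂ Γ.V = Fintype.card V := by
  let t := stdOrthonormalBasis ℂ Γ.V
  have h1 : ∑ j, ∑ x, LinearMap.trace ℂ L (LinearMap.adjoint (op P.P x (t j)) ∘ₗ op P.P x (t j)) =
      Module.finrank ℂ Γ.V * Module.finrank ℂ L := by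
    simp only [← map_sum, sum_adjoint_op_comp, map_smul, LinearMap.trace_id]
    simp
  have h2 : ∑ x, ∑ j, LinearMap.trace ℂ L (op P.P x (t j) ∘ₗ LinearMap.adjoint (op P.P x (t j))) =
      Fintype.card V * Module.finrank ℂ L := by
    simp only [← map_sum, sum_op_comp_adjoint, if_true, LinearMap.trace_id]
    simp
  rw [Finset.sum_comm] at h2
  have h3 : ∑ j, ∑ x, LinearMap.trace ℂ L (op P.P x (t j) ∘ₗ LinearMap.adjoint (op P.P x (t j))) =
      ∑ j, ∑ x, LinearMap.trace ℂ L (LinearMap.adjoint (op P.P x (t j)) ∘ₗ op P.P x (t j)) :=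
    Finset.sum_congr rfl fun j _ => Finset.sum_congr rfl fun x _ => LinearMap.trace_comp_comm' _ _
  rw [h3, h1] at h2
  have hL : (Module.finrank ℂ L : ℂ) ≠ 0 := by simpa using Module.finrank_pos.ne'
  exact_mod_cast mul_right_cancel₀ hL h2

theorem isClassical_iff [Nontrivial L] (P : QuantumIso Γ (classicalGraph G) L) :
    Γ.IsClassical ↔ Module.finrank ℂ Γ.alg.center = Fintype.card V := by
  rw [QuantumGraph.IsClassical, MonoidData.isCommutative_iff_center, ← P.finrank_eq_card]
  exact ⟨fun h => by rw [h, finrank_top], Submodule.eq_top_of_finrank_eq⟩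

/-- The factor dim L is tr(1), so each ⟨t_i t_j, t_j t_i⟩ · 1 may be replaced by Σ_x P_x(t_i t_j)†
P_x(t_j t_i) under the trace. -/
theorem finrank_center {ι : Type*} [Fintype ι] (t : OrthonormalBasis ι ℂ Γ.V) :
    (Module.finrank ℂ Γ.alg.center : ℂ) * Module.finrank ℂ L =
      ∑ x, ∑ i, ∑ j, LinearMap.trace ℂ L (op P.P x (t i) ∘ₗ op P.P x (t j) ∘ₗ
        LinearMap.adjoint (op P.P x (t i)) ∘ₗ LinearMap.adjoint (op P.P x (t j))) := by
  rw [MonoidData.finrank_center Γ.frobenius Γ.special Γ.symmetric t, Finset.sum_mul,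
    Finset.sum_comm]
  refine Finset.sum_congr rfl fun i _ => ?_
  rw [Finset.sum_mul, Finset.sum_comm]
  refine Finset.sum_congr rfl fun j _ => ?_
  rw [← LinearMap.trace_id, ← smul_eq_mul, ← map_smul, ← P.sum_adjoint_op_comp, map_sum]
  refine Finset.sum_congr rfl fun x _ => ?_
  rw [op_mul, op_mul, LinearMap.adjoint_comp, LinearMap.trace_comp_comm', LinearMap.comp_assoc]

end QuantumIso

end Consequences

/-! ## Models of endomorphism algebras -/

section EndModel

variable {H : Type*} [NormedAddCommGroup H] [InnerProductSpace ℂ H] [FiniteDimensional ℂ H]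
  {E : Type*} [NormedAddCommGroup E] [InnerProductSpace ℂ E] [FiniteDimensional ℂ E]

/-- An identification of an algebra with the operators on `H` that has the normalization of the
endomorphism algebra. -/
structure IsEndModel (N : MonoidData E) (τ : E ≃ₗ[ℂ] (H →ₗ[ℂ] H)) : Prop where
  map_mul : ∀ k l, τ (N.mul (k ⊗ₜ l)) =
    ((1 / √(Module.finrank ℂ H : ℝ) : ℝ) : ℂ) • (τ k ∘ₗ τ l)
  map_one : τ N.one = ((√(Module.finrank ℂ H : ℝ) : ℝ) : ℂ) • LinearMap.id
  inner_eq : ∀ k l, inner ℂ k l = LinearMap.trace ℂ H (LinearMap.adjoint (τ k) ∘ₗ τ l)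

variable (H) in
theorem sqrt_finrank_ne_zero [Nontrivial H] : √(Module.finrank ℂ H : ℝ) ≠ 0 := by
  have : 0 < (Module.finrank ℂ H : ℝ) := by exact_mod_cast Module.finrank_pos
  positivity

variable (H) in
theorem one_div_sqrt_mul_sqrt [Nontrivial H] :
    ((1 / √(Module.finrank ℂ H : ℝ) : ℝ) : ℂ) * ((√(Module.finrank ℂ H : ℝ) : ℝ) : ℂ) = 1 := by
  rw [← Complex.ofReal_mul, one_div_mul_cancel (sqrt_finrank_ne_zero H), Complex.ofReal_one]

/-- The operator `|v⟩⟨w|`. -/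
def ketBra (v w : H) : H →ₗ[ℂ] H := (riesz H w).toLinearMap.smulRight v

@[simp]
theorem ketBra_apply (v w u : H) : ketBra v w u = (inner ℂ w u : ℂ) • v := rfl

theorem inner_map_eq_sum {ι : Type*} [Fintype ι] (e : OrthonormalBasis ι ℂ H)
    (v w : H) (f : H →ₗ[ℂ] H) :
    inner ℂ v (f w) = ∑ a, inner ℂ v (f (e a)) * inner ℂ (e a) w := by
  conv_lhs => rw [← e.sum_repr' w]
  simp [mul_comm]

namespace IsEndModel

variable {N : MonoidData E} {τ : E ≃ₗ[ℂ] (H →ₗ[ℂ] H)} (h : IsEndModel N τ)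
include h

/-- Both sides represent the functional m ↦ tr(τ(m) τ(k)): the factor √n of the unit cancels the
1/√n of the product. -/
theorem map_sharp [Nontrivial H] (k : E) : τ (N.sharp k) = LinearMap.adjoint (τ k) := by
  rw [← τ.apply_symm_apply (LinearMap.adjoint (τ k))]
  congr 1
  refine ext_inner_right ℂ fun m => ?_
  rw [MonoidData.inner_sharp, h.inner_eq, h.inner_eq, h.map_one, h.map_mul, τ.apply_symm_apply,
    LinearMap.adjoint_adjoint, map_smulₛₗ, LinearMap.adjoint_id, LinearMap.smul_comp,
    LinearMap.id_comp, smul_smul, Complex.conj_ofReal, mul_comm, one_div_sqrt_mul_sqrt, one_smul,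
    LinearMap.trace_comp_comm']

theorem isRightFrobenius [Nontrivial H] : N.IsRightFrobenius where
  assoc a b c := τ.injective <| by
    simp only [h.map_mul, LinearMap.smul_comp, LinearMap.comp_smul, LinearMap.comp_assoc]
  one_mul a := τ.injective <| by
    rw [h.map_mul, h.map_one, LinearMap.smul_comp, LinearMap.id_comp, smul_smul,
      one_div_sqrt_mul_sqrt, one_smul]
  mul_one a := τ.injective <| by
    rw [h.map_mul, h.map_one, LinearMap.comp_smul, LinearMap.comp_id, smul_smul,
      one_div_sqrt_mul_sqrt, one_smul]
  inner_mul_right a b c := by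
    rw [h.inner_eq, h.inner_eq, h.map_mul, h.map_mul, h.map_sharp, map_smulₛₗ,
      Complex.conj_ofReal, LinearMap.smul_comp, LinearMap.comp_smul, map_smul, map_smul,
      LinearMap.adjoint_comp, LinearMap.comp_assoc, LinearMap.trace_comp_comm',
      LinearMap.comp_assoc]

theorem inner_symm_ketBra (v w : H) (k : E) :
    inner ℂ (τ.symm (ketBra v w)) k = inner ℂ v (τ k w) := by
  let e := stdOrthonormalBasis ℂ H
  rw [h.inner_eq, LinearMap.trace_eq_sum_inner _ e, τ.apply_symm_apply, inner_map_eq_sum e v w]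
  refine Finset.sum_congr rfl fun a _ => ?_
  rw [LinearMap.comp_apply, LinearMap.adjoint_inner_right, ketBra_apply, inner_smul_left,
    inner_conj_symm, mul_comm]

theorem finrank_eq : Module.finrank ℂ E = Module.finrank ℂ H * Module.finrank ℂ H := by
  rw [τ.finrank_eq, Module.finrank_linearMap]

/-- The matrix units. -/
def basis {ι : Type*} [Fintype ι] (e : OrthonormalBasis ι ℂ H) :
    OrthonormalBasis (ι × ι) ℂ E :=
  OrthonormalBasis.mk (v := fun p => τ.symm (ketBra (e p.1) (e p.2)))
    (by
      classical
      rw [orthonormal_iff_ite]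
      intro p q
      rw [h.inner_symm_ketBra, τ.apply_symm_apply, ketBra_apply, inner_smul_right,
        orthonormal_iff_ite.1 e.orthonormal, orthonormal_iff_ite.1 e.orthonormal]
      obtain ⟨a, b⟩ := p
      obtain ⟨c, d⟩ := q
      by_cases h1 : a = c <;> by_cases h2 : b = d <;> simp [h1, h2, eq_comm])
    (by
      intro k _
      have : k = ∑ a, ∑ b, (inner ℂ (e a) (τ k (e b)) : ℂ) • τ.symm (ketBra (e a) (e b)) := by
        apply τ.injective
        simp only [map_sum, map_smul, τ.apply_symm_apply]
        refine e.toBasis.ext fun c => ?_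
        refine ext_inner_left ℂ fun v => ?_
        classical
        simp only [LinearMap.sum_apply, LinearMap.smul_apply, ketBra_apply,
          OrthonormalBasis.coe_toBasis, orthonormal_iff_ite.1 e.orthonormal]
        conv_lhs => rw [← e.sum_repr' (τ k (e c))]
        simp
      rw [this]
      exact Submodule.sum_mem _ fun a _ => Submodule.sum_mem _ fun b _ =>
        Submodule.smul_mem _ _ (Submodule.subset_span ⟨(a, b), rfl⟩))

@[simp]
theorem basis_apply {ι : Type*} [Fintype ι] (e : OrthonormalBasis ι ℂ H) (p : ι × ι) :
    h.basis e p = τ.symm (ketBra (e p.1) (e p.2)) := by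
  simp [basis]

end IsEndModel

/-- The network in a model of the endomorphism algebra. -/
def modelNetwork (τ : E ≃ₗ[ℂ] (H →ₗ[ℂ] H)) {ι : Type*} [Fintype ι] (e : OrthonormalBasis ι ℂ H)
    (S T : E →ₗ[ℂ] E) : ℂ :=
  ∑ a, ∑ b, ∑ c, ∑ d,
    inner ℂ (τ.symm (ketBra (e a) (e b))) (S (τ.symm (ketBra (e c) (e d)))) *
      inner ℂ (τ.symm (ketBra (e c) (e a))) (T (τ.symm (ketBra (e d) (e b))))

theorem sum_rotate {ι : Type*} [Fintype ι] (F : ι → ι → ι → ι → ℂ) :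
    ∑ b, ∑ a, ∑ c, ∑ d, F a b c d = ∑ c, ∑ d, ∑ b, ∑ a, F a b c d := by
  simp only [← Fintype.sum_prod_type']
  exact Fintype.sum_equiv ⟨fun x => (x.2.2.1, x.2.2.2, x.1, x.2.1),
    fun x => (x.2.2.1, x.2.2.2, x.1, x.2.1), fun _ => rfl, fun _ => rfl⟩ _ _ fun _ => rfl

/-- The right-hand side depends on H only through its dimension, which makes networks comparable
across identifications. The proof expands the trace in matrix units, where m is contraction of
adjacent indices. -/
theorem modelNetwork_eq_trace {N : MonoidData E} {τ : E ≃ₗ[ℂ] (H →ₗ[ℂ] H)} (h : IsEndModel N τ)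
    {ι : Type*} [Fintype ι] (e : OrthonormalBasis ι ℂ H) [Nontrivial H] (S T : E →ₗ[ℂ] E) :
    modelNetwork τ e S T = Module.finrank ℂ H * LinearMap.trace ℂ (E ⊗[ℂ] E)
      (TensorProduct.map S T ∘ₗ N.comul ∘ₗ N.mul ∘ₗ (TensorProduct.comm ℂ E E).toLinearMap) := by
  classical
  set c : ℂ := ((1 / √(Module.finrank ℂ H : ℝ) : ℝ) : ℂ) with hc
  -- One factor c = 1/√n comes from m and one from Δ; together they cancel the prefactor dim H.
  have hcc : (Module.finrank ℂ H : ℂ) * (c * c) = 1 := by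
    have h0 : 0 < (Module.finrank ℂ H : ℝ) := by exact_mod_cast Module.finrank_pos
    have h1 : (Module.finrank ℂ H : ℝ) * ((1 / √(Module.finrank ℂ H : ℝ)) *
        (1 / √(Module.finrank ℂ H : ℝ))) = 1 := by
      rw [one_div_mul_one_div, Real.mul_self_sqrt h0.le, mul_one_div_cancel h0.ne']
    rw [hc]
    exact_mod_cast h1
  let U : ι → ι → E := fun a b => τ.symm (ketBra (e a) (e b))
  let b := (h.basis e).tensorProduct (h.basis e)
  rw [LinearMap.trace_comp_comm', LinearMap.trace_eq_sum_inner _ b]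
  simp only [b, Fintype.sum_prod_type, OrthonormalBasis.tensorProduct_apply, h.basis_apply,
    LinearMap.comp_apply, TensorProduct.map_tmul, LinearEquiv.coe_coe, TensorProduct.comm_tmul,
    MonoidData.inner_comul]
  have h1 : ∀ p q r s, N.mul (U p q ⊗ₜ U r s) = if q = r then c • U p s else 0 := by
    intro p q r s
    refine τ.injective ?_
    rw [h.map_mul]
    ext v
    by_cases hq : q = r
    · simp [U, hq, hc]
    · simp [U, hq, orthonormal_iff_ite.1 e.orthonormal]
  have h2 : ∀ p s k l, inner ℂ (U p s) (N.mul (k ⊗ₜ l)) =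
      c * ∑ a, inner ℂ (U p a) k * inner ℂ (U a s) l := by
    intro p s k l
    simp only [U, h.inner_symm_ketBra]
    rw [← inner_map_eq_sum, h.map_mul, LinearMap.smul_apply, inner_smul_right]
    rfl
  have h3 : ∀ p q r s, inner ℂ (N.mul (U p q ⊗ₜ U r s)) (N.mul (T (U r s) ⊗ₜ S (U p q))) =
      if q = r then (c * c) * ∑ a, inner ℂ (U p a) (T (U r s)) * inner ℂ (U a s) (S (U p q))
      else 0 := by
    intro p q r s
    rw [h1]
    split_ifs
    · rw [inner_smul_left, h2, hc, Complex.conj_ofReal, mul_assoc]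
    · simp
  have h4 : ∀ p q, (∑ r, ∑ s, inner ℂ (N.mul (U p q ⊗ₜ U r s)) (N.mul (T (U r s) ⊗ₜ S (U p q)))) =
      (c * c) * ∑ s, ∑ a, inner ℂ (U a s) (S (U p q)) * inner ℂ (U p a) (T (U q s)) := by
    intro p q
    simp only [h3]
    rw [Finset.sum_comm, Finset.mul_sum]
    refine Finset.sum_congr rfl fun s _ => ?_
    rw [Finset.sum_ite_eq, if_pos (Finset.mem_univ _)]
    simp only [mul_comm]
  simp only [U] at h4
  simp only [h4, ← Finset.mul_sum]
  rw [← mul_assoc, hcc, one_mul, modelNetwork, Finset.sum_comm]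
  exact sum_rotate fun a b c d => inner ℂ (U a b) (S (U c d)) * inner ℂ (U c a) (T (U d b))

/-- The value of a network does not depend on the model of the endomorphism algebra. -/
theorem modelNetwork_conj {N : MonoidData E} {τ : E ≃ₗ[ℂ] (H →ₗ[ℂ] H)} (h : IsEndModel N τ)
    {ι : Type*} [Fintype ι] (e : OrthonormalBasis ι ℂ H) [Nontrivial H]
    {K : Type*} [NormedAddCommGroup K] [InnerProductSpace ℂ K] [FiniteDimensional ℂ K]
    {M : MonoidData K} (hM : M.IsRightFrobenius) {f : K →ₗ[ℂ] E}
    (hf : M.IsStarIso N f) (S T : K →ₗ[ℂ] K) :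
    modelNetwork τ e (f ∘ₗ S ∘ₗ LinearMap.adjoint f) (f ∘ₗ T ∘ₗ LinearMap.adjoint f) =
      Module.finrank ℂ H * LinearMap.trace ℂ (K ⊗[ℂ] K) (TensorProduct.map S T ∘ₗ
        M.comul ∘ₗ M.mul ∘ₗ (TensorProduct.comm ℂ K K).toLinearMap) := by
  rw [modelNetwork_eq_trace h]
  congr 1
  have h1 : TensorProduct.map (LinearMap.adjoint f) (LinearMap.adjoint f) ∘ₗ N.comul =
      M.comul ∘ₗ LinearMap.adjoint f := by
    have := congrArg LinearMap.adjoint hf.1.map_mul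
    rw [LinearMap.adjoint_comp, LinearMap.adjoint_comp, TensorProduct.adjoint_map] at this
    exact this.symm
  have h2 : N.mul ∘ₗ (TensorProduct.comm ℂ E E).toLinearMap ∘ₗ TensorProduct.map f f =
      f ∘ₗ M.mul ∘ₗ (TensorProduct.comm ℂ K K).toLinearMap := by
    rw [← LinearMap.comp_assoc _ M.mul, hf.1.map_mul, LinearMap.comp_assoc]
    congr 1
    exact TensorProduct.ext' fun _ _ => by simp
  have h3 : TensorProduct.map (f ∘ₗ S ∘ₗ LinearMap.adjoint f) (f ∘ₗ T ∘ₗ LinearMap.adjoint f) =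
      TensorProduct.map f f ∘ₗ TensorProduct.map S T ∘ₗ
        TensorProduct.map (LinearMap.adjoint f) (LinearMap.adjoint f) := by
    rw [← TensorProduct.map_comp, ← TensorProduct.map_comp]
  rw [h3, LinearMap.comp_assoc, LinearMap.trace_comp_comm']
  congr 1
  simp only [LinearMap.comp_assoc, h2]
  rw [← LinearMap.comp_assoc _ N.comul, h1, LinearMap.comp_assoc, ← LinearMap.comp_assoc _ f,
    hf.adjoint_comp hM, LinearMap.id_comp]

/-- In matrix units, k ↦ f k g has entries ⟨e_a, f e_c⟩⟨e_d, g e_b⟩. The wiring of the network then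
follows one closed loop through f_i, f_j, g_i, g_j. -/
theorem modelNetwork_sum {N : MonoidData E} {τ : E ≃ₗ[ℂ] (H →ₗ[ℂ] H)} (h : IsEndModel N τ)
    {ι : Type*} [Fintype ι] (e : OrthonormalBasis ι ℂ H) {κ : Type*} [Fintype κ]
    (f g : κ → H →ₗ[ℂ] H) (S : E →ₗ[ℂ] E) (hS : ∀ k, τ (S k) = ∑ i, f i ∘ₗ τ k ∘ₗ g i) :
    modelNetwork τ e S S = ∑ i, ∑ j, LinearMap.trace ℂ H (f i ∘ₗ f j ∘ₗ g i ∘ₗ g j) := by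
  have h1 : ∀ a b c d, inner ℂ (τ.symm (ketBra (e a) (e b))) (S (τ.symm (ketBra (e c) (e d)))) =
      ∑ i, inner ℂ (e a) (f i (e c)) * inner ℂ (e d) (g i (e b)) := fun a b c d => by
    rw [h.inner_symm_ketBra, hS, LinearMap.sum_apply, inner_sum]
    simp [inner_smul_right, mul_comm]
  have h2 : ∀ i j, LinearMap.trace ℂ H (f i ∘ₗ f j ∘ₗ g i ∘ₗ g j) = ∑ a, ∑ b, ∑ c, ∑ d,
      (inner ℂ (e a) (f i (e c)) * inner ℂ (e d) (g i (e b))) *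
      (inner ℂ (e c) (f j (e d)) * inner ℂ (e b) (g j (e a))) := fun i j => by
    rw [LinearMap.trace_eq_sum_inner _ e]
    refine Finset.sum_congr rfl fun a _ => ?_
    simp only [LinearMap.comp_apply]
    rw [inner_map_eq_sum e (e a) _ (f i)]
    simp only [inner_map_eq_sum e _ (g i _) (f j), inner_map_eq_sum e _ (g j _) (g i),
      Finset.mul_sum]
    simp only [← Fintype.sum_prod_type']
    refine Fintype.sum_equiv ⟨fun x => (x.2.2, x.1, x.2.1), fun x => (x.2.1, x.2.2, x.1),
      fun _ => rfl, fun _ => rfl⟩ _ _ fun x => ?_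
    simp only [Equiv.coe_fn_mk]
    ring
  have h3 : ∀ F : ι → κ → ℂ, ∑ a, ∑ i, F a i = ∑ i, ∑ a, F a i := fun F => Finset.sum_comm
  simp only [modelNetwork, h1, h2, Finset.sum_mul_sum, h3]

end EndModel

/-! ## The dimension of the center -/

section EndAlgebra

variable {H : Type*} [NormedAddCommGroup H] [InnerProductSpace ℂ H] [FiniteDimensional ℂ H]

/-- The operator on `H` given by a vector of `H ⊗ H*`. -/
def toEnd : H ⊗[ℂ] StrongDual ℂ H →ₗ[ℂ] H →ₗ[ℂ] H :=
  TensorProduct.lift (LinearMap.mk₂ ℂ (fun v φ => φ.toLinearMap.smulRight v)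
    (fun _ _ _ => LinearMap.ext fun _ => smul_add _ _ _)
    (fun _ _ _ => LinearMap.ext fun _ => smul_comm _ _ _)
    (fun _ _ _ => LinearMap.ext fun _ => add_smul _ _ _)
    (fun _ _ _ => LinearMap.ext fun _ => mul_smul _ _ _))

@[simp]
theorem toEnd_tmul (v : H) (φ : StrongDual ℂ H) (w : H) : toEnd (v ⊗ₜ[ℂ] φ) w = φ w • v := rfl

theorem inner_tmul_riesz (v w : H) (k : H ⊗[ℂ] StrongDual ℂ H) :
    inner ℂ (v ⊗ₜ[ℂ] riesz H w) k = inner ℂ v (toEnd k w) := by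
  induction k with
  | zero => exact (inner_zero_right (𝕜 := ℂ) (E := H ⊗[ℂ] StrongDual ℂ H) _).trans (by simp)
  | add k l hk hl =>
    refine (inner_add_right (𝕜 := ℂ) (E := H ⊗[ℂ] StrongDual ℂ H) _ _ _).trans ?_
    rw [map_add, LinearMap.add_apply, inner_add_right, ← hk, ← hl]
  | tmul u φ =>
    rw [TensorProduct.inner_tmul, inner_riesz_left, toEnd_tmul, inner_smul_right, mul_comm]

theorem toEnd_injective : Function.Injective (toEnd : H ⊗[ℂ] StrongDual ℂ H →ₗ[ℂ] H →ₗ[ℂ] H) := by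
  intro k l h
  refine (TensorProduct.ext_iff_inner_left (𝕜 := ℂ) (F := StrongDual ℂ H)).2 fun v φ => ?_
  obtain ⟨w, rfl⟩ := (riesz H).surjective φ
  rw [inner_tmul_riesz, inner_tmul_riesz, h]

theorem toEnd_surjective :
    Function.Surjective (toEnd : H ⊗[ℂ] StrongDual ℂ H →ₗ[ℂ] H →ₗ[ℂ] H) := by
  intro f
  let e := stdOrthonormalBasis ℂ H
  refine ⟨∑ i, f (e i) ⊗ₜ[ℂ] riesz H (e i), ?_⟩
  ext v
  conv_rhs => rw [← e.sum_repr' v]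
  simp [LinearMap.sum_apply, riesz_apply]

variable (H) in
/-- The identification of `H ⊗ H*` with the operators on `H`. -/
def toEndEquiv : (H ⊗[ℂ] StrongDual ℂ H) ≃ₗ[ℂ] (H →ₗ[ℂ] H) :=
  LinearEquiv.ofBijective toEnd ⟨toEnd_injective, toEnd_surjective⟩

theorem toEndEquiv_symm_ketBra (v w : H) :
    (toEndEquiv H).symm (ketBra v w) = v ⊗ₜ[ℂ] riesz H w := by
  rw [LinearEquiv.symm_apply_eq]
  rfl

theorem toEnd_map (f g : H →ₗ[ℂ] H) (k : H ⊗[ℂ] StrongDual ℂ H) :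
    toEnd (TensorProduct.map f (precomp g) k) = f ∘ₗ toEnd k ∘ₗ g := by
  induction k with
  | zero => ext; simp
  | add k l hk hl => rw [map_add, map_add, map_add, hk, hl, LinearMap.add_comp, LinearMap.comp_add]
  | tmul u φ => ext; simp

theorem inner_eq_trace (k l : H ⊗[ℂ] StrongDual ℂ H) :
    inner ℂ k l = LinearMap.trace ℂ H (LinearMap.adjoint (toEnd k) ∘ₗ toEnd l) := by
  let e := stdOrthonormalBasis ℂ H
  rw [LinearMap.trace_eq_sum_inner _ e]
  simp only [LinearMap.comp_apply, LinearMap.adjoint_inner_right]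
  induction k with
  | zero => exact (inner_zero_left (𝕜 := ℂ) (E := H ⊗[ℂ] StrongDual ℂ H) _).trans (by simp)
  | add k m hk hm =>
    refine (inner_add_left (𝕜 := ℂ) (E := H ⊗[ℂ] StrongDual ℂ H) _ _ _).trans ?_
    rw [map_add]
    simp only [LinearMap.add_apply, inner_add_left, Finset.sum_add_distrib]
    rw [← hk, ← hm]
  | tmul v φ =>
    obtain ⟨w, rfl⟩ := (riesz H).surjective φ
    rw [inner_tmul_riesz]
    conv_lhs => rw [← e.sum_repr' w]
    simp only [toEnd_tmul, riesz_apply, map_sum, map_smul, inner_sum, inner_smul_right,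
      inner_smul_left, inner_conj_symm]

theorem toEnd_mul (k l : H ⊗[ℂ] StrongDual ℂ H) :
    toEnd ((endAlgebra H).mul (k ⊗ₜ l)) =
      ((1 / √(Module.finrank ℂ H : ℝ) : ℝ) : ℂ) • (toEnd k ∘ₗ toEnd l) := by
  induction k with
  | zero => simp
  | add k m hk hm =>
    simp only [TensorProduct.add_tmul, map_add, hk, hm, LinearMap.add_comp, smul_add]
  | tmul v φ =>
    induction l with
    | zero => simp
    | add k m hk hm =>
      simp only [TensorProduct.tmul_add, map_add, hk, hm, LinearMap.comp_add, smul_add]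
    | tmul w ψ =>
      ext x
      simp only [endAlgebra, LinearMap.smul_apply, LinearMap.comp_apply, LinearEquiv.coe_coe,
        TensorProduct.assoc_tmul, LinearMap.lTensor_tmul, TensorProduct.assoc_symm_tmul,
        LinearMap.rTensor_tmul, TensorProduct.lid_tmul, capLeft, TensorProduct.lift.tmul,
        LinearMap.mk₂_apply, map_smul, toEnd_tmul, smul_apply, smul_eq_mul,
        mul_smul]
      rw [smul_comm (φ w)]

theorem toEnd_unit :
    toEnd ((endAlgebra H).unit 1) = ((√(Module.finrank ℂ H : ℝ) : ℝ) : ℂ) • LinearMap.id := by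
  ext v
  let e := stdOrthonormalBasis ℂ H
  rw [endAlgebra, LinearMap.smul_apply, cupRight_one e, map_smul,
    LinearMap.smul_apply, map_sum, LinearMap.sum_apply]
  conv_rhs => rw [LinearMap.smul_apply, LinearMap.id_apply, ← e.sum_repr' v]
  rfl

variable (H) in
theorem endAlgebra_isEndModel :
    IsEndModel (E := H ⊗[ℂ] StrongDual ℂ H) (endAlgebra H) (toEndEquiv H) :=
  ⟨toEnd_mul, toEnd_unit, inner_eq_trace⟩

theorem network_eq_modelNetwork {ι : Type*} [Fintype ι] (e : OrthonormalBasis ι ℂ H)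
    (S T : H ⊗[ℂ] StrongDual ℂ H →ₗ[ℂ] H ⊗[ℂ] StrongDual ℂ H) :
    network e S T = modelNetwork (E := H ⊗[ℂ] StrongDual ℂ H) (toEndEquiv H) e S T := by
  simp only [network, ← toEndEquiv_symm_ketBra]
  rfl

end EndAlgebra

/-! ### The trace formula for an arbitrary splitting of X -/

section Splitting

variable {V : Type*} [Fintype V] [DecidableEq V] {G : SimpleGraph V}
  {K A : Type*} [NormedAddCommGroup K] [InnerProductSpace ℂ K] [FiniteDimensional ℂ K]
  [NormedAddCommGroup A] [InnerProductSpace ℂ A] [FiniteDimensional ℂ A]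
  {E : Type*} [NormedAddCommGroup E] [InnerProductSpace ℂ E] [FiniteDimensional ℂ E]

theorem entry_eq_op (X : QuantumIso (classicalGraph G) (classicalGraph G) K) (x y : V) :
    entry X x y = op X.P y (EuclideanSpace.single x 1) := rfl

theorem coord_lTensor (g : K →ₗ[ℂ] E) (x : V) (y : EuclideanSpace ℂ V ⊗[ℂ] K) :
    coord x (g.lTensor (EuclideanSpace ℂ V) y) = g (coord x y) := by
  induction y with
  | zero => simp
  | add y z hy hz => simp only [map_add, hy, hz]
  | tmul v k => simp

theorem isIntertwiner_iff_op (P : K ⊗[ℂ] A →ₗ[ℂ] EuclideanSpace ℂ V ⊗[ℂ] K)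
    (Q : E ⊗[ℂ] A →ₗ[ℂ] EuclideanSpace ℂ V ⊗[ℂ] E) (g : K →ₗ[ℂ] E) :
    IsIntertwiner P Q g ↔ ∀ x a, op Q x a ∘ₗ g = g ∘ₗ op P x a := by
  constructor
  · intro h x a
    ext k
    have := congrArg (coord x) (LinearMap.congr_fun h (k ⊗ₜ a))
    simpa [coord_lTensor, ← op_apply] using this
  · intro h
    refine TensorProduct.ext' fun k a => coord_ext fun x => ?_
    have := LinearMap.congr_fun (h x a) k
    simpa [coord_lTensor, ← op_apply] using this

theorem toEnd_op_compCross {L : Type*} [NormedAddCommGroup L] [InnerProductSpace ℂ L]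
    [FiniteDimensional ℂ L] (P : L ⊗[ℂ] A →ₗ[ℂ] EuclideanSpace ℂ V ⊗[ℂ] L)
    {ι : Type*} [Fintype ι] (t : OrthonormalBasis ι ℂ A) (x y : V) (k : L ⊗[ℂ] StrongDual ℂ L) :
    toEndEquiv L (op (H := L ⊗[ℂ] StrongDual ℂ L) (compCross P (dualCross P)) y
      (EuclideanSpace.single x (1 : ℂ)) k) =
      ∑ j, op P y (t j) ∘ₗ toEndEquiv L k ∘ₗ LinearMap.adjoint (op P x (t j)) := by
  have := congrArg (toEnd (H := L)) (coord_compCross_dualCross P t x y k)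
  simp only [map_sum, toEnd_map] at this
  exact this

/-- As g is an intertwiner and g g† = 1, conjugating X_xx by g gives the diagonal entry of the
target crossing. This has the form k ↦ Σ_j f_j k g_j required by `modelNetwork_sum`, with g_j =
f_j†. -/
theorem sum_modelNetwork_entry {Γ : QuantumGraph} {L : Type*}
    [NormedAddCommGroup L] [InnerProductSpace ℂ L] [FiniteDimensional ℂ L] [Nontrivial L]
    (P : QuantumIso Γ (classicalGraph G) L) {κ : Type*} [Fintype κ] (e : OrthonormalBasis κ ℂ L)
    {N : MonoidData E} {τ : E ≃ₗ[ℂ] (L →ₗ[ℂ] L)} (h : IsEndModel N τ)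
    (X : QuantumIso (classicalGraph G) (classicalGraph G) K) {M : MonoidData K}
    (g : K →ₗ[ℂ] E) (hg : M.IsStarIso N g)
    (C : E ⊗[ℂ] EuclideanSpace ℂ V →ₗ[ℂ] EuclideanSpace ℂ V ⊗[ℂ] E)
    (hint : IsIntertwiner (A := EuclideanSpace ℂ V) (B := EuclideanSpace ℂ V) X.P C g)
    (hC : ∀ x k, τ (op C x (EuclideanSpace.single x (1 : ℂ)) k) =
      ∑ j, op P.P x (stdOrthonormalBasis ℂ Γ.V j) ∘ₗ τ k ∘ₗ
        LinearMap.adjoint (op P.P x (stdOrthonormalBasis ℂ Γ.V j))) :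
    ∑ x, modelNetwork τ e (g ∘ₗ entry X x x ∘ₗ LinearMap.adjoint g)
        (g ∘ₗ entry X x x ∘ₗ LinearMap.adjoint g) =
      Module.finrank ℂ Γ.alg.center * Module.finrank ℂ L := by
  rw [P.finrank_center (stdOrthonormalBasis ℂ Γ.V)]
  refine Finset.sum_congr rfl fun x _ => modelNetwork_sum h e _ _ _ fun k => ?_
  rw [← hC, entry_eq_op, ← LinearMap.comp_assoc, ← (isIntertwiner_iff_op X.P C g).1 hint,
    LinearMap.comp_assoc, hg.comp_adjoint h.isRightFrobenius, LinearMap.comp_id]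

theorem sum_network_diagonal {Γ : QuantumGraph} {L : Type*}
    [NormedAddCommGroup L] [InnerProductSpace ℂ L] [FiniteDimensional ℂ L] [Nontrivial L]
    (P : QuantumIso Γ (classicalGraph G) L) {κ : Type*} [Fintype κ] (e : OrthonormalBasis κ ℂ L)
    (X : QuantumIso (classicalGraph G) (classicalGraph G) K) {M : MonoidData K}
    (g : K →ₗ[ℂ] L ⊗[ℂ] StrongDual ℂ L)
    (hg : MonoidData.IsStarIso (B := L ⊗[ℂ] StrongDual ℂ L) M (endAlgebra L) g)
    (hint : IsIntertwiner X.P (compCross P.P (dualCross P.P)) g) :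
    ∑ x, modelNetwork (E := L ⊗[ℂ] StrongDual ℂ L) (toEndEquiv L) e
        (diagonal X g x) (diagonal X g x) =
      Module.finrank ℂ Γ.alg.center * Module.finrank ℂ L :=
  sum_modelNetwork_entry (E := L ⊗[ℂ] StrongDual ℂ L) P e (endAlgebra_isEndModel L) X g hg
    (compCross P.P (dualCross P.P)) hint
    fun x k => toEnd_op_compCross P.P (stdOrthonormalBasis ℂ Γ.V) x x k

/-- Both networks equal the same trace on K ⊗ K, up to the factors dim H and dim L. These agree
because both squares equal dim K. -/
theorem modelNetwork_independent {H L : Type*}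
    [NormedAddCommGroup H] [InnerProductSpace ℂ H] [FiniteDimensional ℂ H] [Nontrivial H]
    [NormedAddCommGroup L] [InnerProductSpace ℂ L] [FiniteDimensional ℂ L]
    {E' : Type*} [NormedAddCommGroup E'] [InnerProductSpace ℂ E'] [FiniteDimensional ℂ E']
    {N : MonoidData E} {τ : E ≃ₗ[ℂ] (H →ₗ[ℂ] H)} (h : IsEndModel N τ)
    {N' : MonoidData E'} {τ' : E' ≃ₗ[ℂ] (L →ₗ[ℂ] L)} (h' : IsEndModel N' τ')
    {M : MonoidData K} (hM : M.IsRightFrobenius) {f : K →ₗ[ℂ] E} (hf : M.IsStarIso N f)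
    {g : K →ₗ[ℂ] E'} (hg : M.IsStarIso N' g) :
    Nontrivial L ∧ Module.finrank ℂ L = Module.finrank ℂ H ∧
    ∀ {ι κ : Type*} [Fintype ι] [Fintype κ] (e : OrthonormalBasis ι ℂ H)
      (e' : OrthonormalBasis κ ℂ L) (S T : K →ₗ[ℂ] K),
      modelNetwork τ e (f ∘ₗ S ∘ₗ LinearMap.adjoint f) (f ∘ₗ T ∘ₗ LinearMap.adjoint f) =
        modelNetwork τ' e' (g ∘ₗ S ∘ₗ LinearMap.adjoint g) (g ∘ₗ T ∘ₗ LinearMap.adjoint g) := by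
  have hfK : Module.finrank ℂ K = Module.finrank ℂ E :=
    (LinearEquiv.ofLinearMap f (LinearMap.adjoint f) (hf.comp_adjoint h.isRightFrobenius)
      (hf.adjoint_comp hM)).finrank_eq
  -- L is not assumed nonzero; if it were zero, g would embed a space of dimension (dim H)² > 0 into
  -- zero.
  have hL : Nontrivial L := by
    by_contra hL
    rw [not_nontrivial_iff_subsingleton] at hL
    have h1 : Function.Injective g := Function.LeftInverse.injective
      (g := LinearMap.adjoint g) fun k => LinearMap.congr_fun (hg.adjoint_comp hM) k
    have h2 := LinearMap.finrank_le_finrank_of_injective h1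
    rw [hfK, h.finrank_eq, h'.finrank_eq, Module.finrank_zero_of_subsingleton (M := L)] at h2
    have := Module.finrank_pos (R := ℂ) (M := H)
    nlinarith
  have hgK : Module.finrank ℂ K = Module.finrank ℂ E' :=
    (LinearEquiv.ofLinearMap g (LinearMap.adjoint g) (hg.comp_adjoint h'.isRightFrobenius)
      (hg.adjoint_comp hM)).finrank_eq
  have hLH : Module.finrank ℂ L = Module.finrank ℂ H := by
    rw [hfK, h.finrank_eq, h'.finrank_eq] at hgK
    exact (Nat.mul_self_inj.1 hgK).symm
  refine ⟨hL, hLH, fun e e' S T => ?_⟩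
  rw [modelNetwork_conj h e hM hf, modelNetwork_conj h' e' hM hg, hLH]

theorem finrank_center_eq {Γ : QuantumGraph} {L : Type*}
    [NormedAddCommGroup L] [InnerProductSpace ℂ L] [FiniteDimensional ℂ L]
    {P : QuantumIso Γ (classicalGraph G) L}
    {H : Type*} [NormedAddCommGroup H] [InnerProductSpace ℂ H]
    [FiniteDimensional ℂ H] [Nontrivial H]
    {X : QuantumIso (classicalGraph G) (classicalGraph G) K} {M : MonoidData K}
    (hM : M.IsRightFrobenius) {f : K →ₗ[ℂ] H ⊗[ℂ] StrongDual ℂ H}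
    (hf : MonoidData.IsStarIso (B := H ⊗[ℂ] StrongDual ℂ H) M (endAlgebra H) f)
    {ι : Type*} [Fintype ι] (e : OrthonormalBasis ι ℂ H) (hP : SplitsAs X M P) :
    Nontrivial L ∧ (Module.finrank ℂ Γ.alg.center : ℂ) =
      1 / (Module.finrank ℂ H : ℂ) * ∑ x, network e (diagonal X f x) (diagonal X f x) := by
  obtain ⟨g, hg, hint⟩ := hP
  obtain ⟨hL, hLH, hnet⟩ := modelNetwork_independent (E := H ⊗[ℂ] StrongDual ℂ H)
    (E' := L ⊗[ℂ] StrongDual ℂ L) (endAlgebra_isEndModel H) (endAlgebra_isEndModel L) hM hf hg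
  refine ⟨hL, ?_⟩
  have h1 := sum_network_diagonal P (stdOrthonormalBasis ℂ L) X g hg hint
  have h2 : ∀ x, network e (diagonal X f x) (diagonal X f x) =
      modelNetwork (E := L ⊗[ℂ] StrongDual ℂ L) (toEndEquiv L) (stdOrthonormalBasis ℂ L)
        (diagonal X g x) (diagonal X g x) := fun x =>
    (network_eq_modelNetwork e _ _).trans (hnet e _ _ _)
  have hH : (Module.finrank ℂ H : ℂ) ≠ 0 := by
    exact_mod_cast (Module.finrank_pos (R := ℂ) (M := H)).ne'
  simp only [h2, h1, hLH]
  field_simp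

end Splitting

/-! ## Quantum graphs of operators -/

theorem linearMap_comp_sum {H : Type*} [AddCommGroup H] [Module ℂ H] {ι : Type*} (s : Finset ι)
    (f : H →ₗ[ℂ] H) (g : ι → H →ₗ[ℂ] H) : f ∘ₗ ∑ i ∈ s, g i = ∑ i ∈ s, f ∘ₗ g i :=
  Finset.mul_sum (R := Module.End ℂ H) s g f

theorem sum_linearMap_comp {H : Type*} [AddCommGroup H] [Module ℂ H] {ι : Type*} (s : Finset ι)
    (f : H →ₗ[ℂ] H) (g : ι → H →ₗ[ℂ] H) : (∑ i ∈ s, g i) ∘ₗ f = ∑ i ∈ s, g i ∘ₗ f :=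
  Finset.sum_mul (R := Module.End ℂ H) s g f

section OperatorAlgebra

variable {V : Type*} [Fintype V] [DecidableEq V]
  {H : Type*} [NormedAddCommGroup H] [InnerProductSpace ℂ H] [FiniteDimensional ℂ H]
  {A : Type*} [NormedAddCommGroup A] [InnerProductSpace ℂ A] [FiniteDimensional ℂ A]

/-- A Hilbert space of families of operators indexed by the vertices of `G` that is an algebra
under pointwise multiplication, is closed under adjoints and under the adjacency matrix, and whose
elements assemble into a unitary `H ⊗ A → ℂ^V ⊗ H`. -/
structure IsOperatorAlgebra (G : SimpleGraph V) (T : V → A →ₗ[ℂ] H →ₗ[ℂ] H) : Prop where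
  sum_adjoint_comp : ∀ a b, ∑ x, LinearMap.adjoint (T x a) ∘ₗ T x b = inner ℂ a b • LinearMap.id
  sum_comp_adjoint : ∀ x y, ∑ j, T y (stdOrthonormalBasis ℂ A j) ∘ₗ
    LinearMap.adjoint (T x (stdOrthonormalBasis ℂ A j)) = if x = y then LinearMap.id else 0
  exists_mul : ∀ a b, ∃ c, ∀ x, T x c = T x b ∘ₗ T x a
  exists_one : ∃ c, ∀ x, T x c = LinearMap.id
  exists_adjoint : ∀ a, ∃ c, ∀ x, T x c = LinearMap.adjoint (T x a)
  exists_adj : ∀ a, ∃ c, ∀ x, T x c = ∑ y, adjacency G x y • T y a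

namespace IsOperatorAlgebra

variable {G : SimpleGraph V} {T : V → A →ₗ[ℂ] H →ₗ[ℂ] H} (h : IsOperatorAlgebra G T)
  [Nontrivial H]
include h

/-- The first unitarity relation makes T jointly injective when H ≠ 0. All algebraic laws on A thus
reduce to laws of operators. -/
theorem ext {a b : A} (hab : ∀ x, T x a = T x b) : a = b := by
  have h1 : ∀ c : A, (∀ x, T x c = 0) → c = 0 := fun c hc => by
    have := h.sum_adjoint_comp c c
    simp only [hc, LinearMap.comp_zero, Finset.sum_const_zero] at this
    obtain ⟨v, hv⟩ := exists_ne (0 : H)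
    have h2 := LinearMap.congr_fun this v
    rw [LinearMap.zero_apply, LinearMap.smul_apply, LinearMap.id_apply, eq_comm,
      smul_eq_zero_iff_left hv, inner_self_eq_zero] at h2
    exact h2
  exact sub_eq_zero.1 (h1 _ fun x => by rw [map_sub, hab, sub_self])

theorem inner_ext {a b c d : A} (hab : ∑ x, LinearMap.adjoint (T x a) ∘ₗ T x b =
    ∑ x, LinearMap.adjoint (T x c) ∘ₗ T x d) : inner ℂ a b = inner ℂ c d := by
  rw [h.sum_adjoint_comp, h.sum_adjoint_comp] at hab
  obtain ⟨v, hv⟩ := exists_ne (0 : H)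
  exact smul_left_injective ℂ hv (LinearMap.congr_fun hab v)

/-- Under the trace, operators may be permuted cyclically; this is what makes the counit tracial. -/
theorem inner_ext_trace {a b c d : A}
    (hab : ∑ x, LinearMap.trace ℂ H (LinearMap.adjoint (T x a) ∘ₗ T x b) =
      ∑ x, LinearMap.trace ℂ H (LinearMap.adjoint (T x c) ∘ₗ T x d)) :
    inner ℂ a b = inner ℂ c d := by
  rw [← map_sum, ← map_sum, h.sum_adjoint_comp, h.sum_adjoint_comp, map_smul, map_smul,
    LinearMap.trace_id] at hab
  refine mul_right_cancel₀ ?_ hab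
  exact_mod_cast (Module.finrank_pos (R := ℂ) (M := H)).ne'

/-- The pointwise product, in the reversed order. -/
def mulFun (a b : A) : A := (h.exists_mul a b).choose

/-- The adjacency matrix applied to an element. -/
def adjFun (a : A) : A := (h.exists_adj a).choose

theorem map_mulFun (x : V) (a b : A) : T x (h.mulFun a b) = T x b ∘ₗ T x a :=
  (h.exists_mul a b).choose_spec x

theorem map_adjFun (x : V) (a : A) : T x (h.adjFun a) = ∑ y, adjacency G x y • T y a :=
  (h.exists_adj a).choose_spec x

/-- The algebra structure. -/
def alg : MonoidData A where
  mul := TensorProduct.lift (LinearMap.mk₂ ℂ h.mulFun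
    (fun a b c => h.ext fun x => by simp only [map_add, h.map_mulFun, LinearMap.comp_add])
    (fun r a b => h.ext fun x => by simp only [map_smul, h.map_mulFun, LinearMap.comp_smul])
    (fun a b c => h.ext fun x => by simp only [map_add, h.map_mulFun, LinearMap.add_comp])
    (fun r a b => h.ext fun x => by simp only [map_smul, h.map_mulFun, LinearMap.smul_comp]))
  unit := LinearMap.toSpanSingleton ℂ A h.exists_one.choose

/-- The adjacency matrix. -/
def adj : A →ₗ[ℂ] A where
  toFun := h.adjFun
  map_add' a b := h.ext fun x => by
    simp only [map_add, h.map_adjFun, smul_add, Finset.sum_add_distrib]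
  map_smul' r a := h.ext fun x => by
    simp only [map_smul, h.map_adjFun, Finset.smul_sum, RingHom.id_apply]
    exact Finset.sum_congr rfl fun y _ => smul_comm _ _ _

theorem map_mul (x : V) (a b : A) : T x (h.alg.mul (a ⊗ₜ b)) = T x b ∘ₗ T x a := by
  rw [alg, TensorProduct.lift.tmul, LinearMap.mk₂_apply]
  exact h.map_mulFun x a b

theorem map_one (x : V) : T x h.alg.one = LinearMap.id := by
  rw [MonoidData.one, alg, LinearMap.toSpanSingleton_apply, one_smul]
  exact h.exists_one.choose_spec x

theorem map_adj (x : V) (a : A) : T x (h.adj a) = ∑ y, adjacency G x y • T y a :=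
  h.map_adjFun x a

theorem inner_one_mul (a b : A) :
    inner ℂ h.alg.one (h.alg.mul (a ⊗ₜ b)) = inner ℂ h.alg.one (h.alg.mul (b ⊗ₜ a)) := by
  refine h.inner_ext_trace (Finset.sum_congr rfl fun x _ => ?_)
  rw [h.map_mul, h.map_mul, h.map_one, LinearMap.adjoint_id, LinearMap.id_comp, LinearMap.id_comp,
    LinearMap.trace_comp_comm']

theorem map_sharp (x : V) (a : A) : T x (h.alg.sharp a) = LinearMap.adjoint (T x a) := by
  obtain ⟨b, hb⟩ := h.exists_adjoint a
  rw [← hb]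
  congr 1
  refine ext_inner_right ℂ fun c => ?_
  rw [MonoidData.inner_sharp, h.inner_one_mul]
  refine h.inner_ext_trace (Finset.sum_congr rfl fun x _ => ?_)
  rw [h.map_mul, h.map_one, LinearMap.adjoint_id, LinearMap.id_comp, hb,
    LinearMap.adjoint_adjoint, LinearMap.trace_comp_comm']

theorem isRightFrobenius : h.alg.IsRightFrobenius where
  assoc a b c := h.ext fun x => by simp only [h.map_mul, LinearMap.comp_assoc]
  one_mul a := h.ext fun x => by rw [h.map_mul, h.map_one, LinearMap.comp_id]
  mul_one a := h.ext fun x => by rw [h.map_mul, h.map_one, LinearMap.id_comp]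
  inner_mul_right a b c := h.inner_ext <| Finset.sum_congr rfl fun x _ => by
    rw [h.map_mul, h.map_mul, h.map_sharp, LinearMap.adjoint_comp, LinearMap.comp_assoc]

theorem inner_adj (a b : A) : inner ℂ (h.adj a) b = inner ℂ a (h.adj b) := by
  refine h.inner_ext ?_
  simp only [h.map_adj, map_sum, sum_linearMap_comp, linearMap_comp_sum, map_smulₛₗ,
    LinearMap.smul_comp, LinearMap.comp_smul]
  rw [Finset.sum_comm]
  refine Finset.sum_congr rfl fun x _ => Finset.sum_congr rfl fun y _ => ?_
  rw [adjacency_symm G x y]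
  by_cases hxy : y = x ∨ G.Adj y x <;> simp [adjacency, hxy]

theorem sum_comp_adjoint_comp (u v : V) (a : A) : ∑ j, T u (stdOrthonormalBasis ℂ A j) ∘ₗ
    LinearMap.adjoint (T v (stdOrthonormalBasis ℂ A j)) ∘ₗ T v a = if v = u then T v a else 0 := by
  simp only [← LinearMap.comp_assoc, ← sum_linearMap_comp, h.sum_comp_adjoint]
  split_ifs <;> simp

/-- The quantum graph on the algebra. -/
def quantumGraph : QuantumGraph where
  V := A
  alg := h.alg
  frobenius := h.isRightFrobenius.isDaggerFrobenius h.inner_one_mul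
  special := (h.isRightFrobenius.isSpecial_iff (stdOrthonormalBasis ℂ A)).2 <| h.ext fun x => by
    simp only [map_sum, h.map_mul, h.map_sharp, h.map_one, h.sum_comp_adjoint, if_true]
  symmetric := MonoidData.IsRightFrobenius.isSymmetric h.inner_one_mul
  adj := h.adj
  adj_adjoint := ((LinearMap.eq_adjoint_iff _ _).2 h.inner_adj).symm
  -- At x the left side is Σ_{u,v} A_xu A_xv Σ_j T_u(t_j) T_v(t_j)† T_v(a), with A the adjacency
  -- matrix. Unitarity forces u = v, and A_xu² = A_xu.
  adj_idem := LinearMap.ext fun a => h.ext fun x => by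
    have h1 := fun u v => h.sum_comp_adjoint_comp u v a
    have h2 : ∀ u, adjacency G x u * adjacency G x u = adjacency G x u := fun u => by
      by_cases h : x = u ∨ G.Adj x u <;> simp [adjacency, h]
    have h3 : ∀ F : Fin (Module.finrank ℂ A) → V → H →ₗ[ℂ] H,
        ∑ j, ∑ u, F j u = ∑ u, ∑ j, F j u := fun F => Finset.sum_comm
    simp only [LinearMap.comp_apply, h.isRightFrobenius.comul_apply (stdOrthonormalBasis ℂ A),
      map_sum, TensorProduct.map_tmul, h.map_mul, h.map_adj, h.map_sharp, sum_linearMap_comp,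
      linearMap_comp_sum, LinearMap.smul_comp, LinearMap.comp_smul, h3, ← Finset.smul_sum, h1]
    simp [smul_smul, h2]
  adj_symm := LinearMap.ext fun a => h.ext fun x => by
    rw [MonoidData.transpose_apply, ← (LinearMap.eq_adjoint_iff _ _).2 h.inner_adj]
    simp only [h.map_sharp, h.map_adj, map_sum, map_smulₛₗ, LinearMap.adjoint_adjoint]
    refine Finset.sum_congr rfl fun y _ => ?_
    by_cases hxy : x = y ∨ G.Adj x y <;> simp [adjacency, hxy]
  -- With a single adjacency matrix, unitarity leaves only A_xx T_x(a), and A_xx = 1 by reflexivity.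
  adj_refl := LinearMap.ext fun a => h.ext fun x => by
    have h1 := fun u v => h.sum_comp_adjoint_comp u v a
    have h3 : ∀ F : Fin (Module.finrank ℂ A) → V → H →ₗ[ℂ] H,
        ∑ j, ∑ u, F j u = ∑ u, ∑ j, F j u := fun F => Finset.sum_comm
    simp only [LinearMap.comp_apply, h.isRightFrobenius.comul_apply (stdOrthonormalBasis ℂ A),
      map_sum, LinearMap.rTensor_tmul, h.map_mul, h.map_adj, h.map_sharp,
      linearMap_comp_sum, LinearMap.comp_smul, h3, ← Finset.smul_sum, h1]
    simp [adjacency]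

/-- The quantum isomorphism to `G`. -/
def quantumIso : QuantumIso h.quantumGraph (classicalGraph G) H where
  P := ofOp T
  comul := (comul_iff (ofOp T) h.isRightFrobenius (stdOrthonormalBasis ℂ A)).2 fun x y a => by
    simp only [op_ofOp, h.map_mul, h.map_sharp, ← LinearMap.comp_assoc, ← sum_linearMap_comp,
      h.sum_comp_adjoint]
    split_ifs <;> simp
  counit := (counit_iff (ofOp T) h.alg).2 fun a => by
    simp only [op_ofOp, ← h.sum_adjoint_comp, h.map_one, LinearMap.adjoint_id, LinearMap.id_comp]
  adjoint_eq := (adjoint_iff (ofOp T) h.isRightFrobenius).2 fun x a => by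
    simp only [op_ofOp, h.map_sharp]
  mul := (mul_iff (ofOp T) h.alg).2 fun x a b => by simp only [op_ofOp, h.map_mul]
  unit := (unit_iff (ofOp T) h.alg).2 fun x => by simp only [op_ofOp, h.map_one]
  adj := (adj_iff (ofOp T) h.adj G).2 fun x a => by simp only [op_ofOp, h.map_adj]

theorem toEnd_op_quantumIso (x y : V) (k : H ⊗[ℂ] StrongDual ℂ H) :
    toEndEquiv H (op (H := H ⊗[ℂ] StrongDual ℂ H)
      (compCross h.quantumIso.P (dualCross h.quantumIso.P)) y
      (EuclideanSpace.single x (1 : ℂ)) k) =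
      ∑ j, T y (stdOrthonormalBasis ℂ A j) ∘ₗ toEndEquiv H k ∘ₗ
        LinearMap.adjoint (T x (stdOrthonormalBasis ℂ A j)) := by
  have := toEnd_op_compCross (ofOp T) (stdOrthonormalBasis ℂ A) x y k
  simp only [op_ofOp] at this
  exact this

end IsOperatorAlgebra
end OperatorAlgebra

/-! ## Intertwining families of operators -/

section Action

variable {V : Type*} [Fintype V] [DecidableEq V]
  {H : Type*} [NormedAddCommGroup H] [InnerProductSpace ℂ H] [FiniteDimensional ℂ H]

/-- A quantum automorphism of `G` on the operators of `H`, with matrix entries `Y x y`, that is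
compatible with the algebra structure of the operators. -/
structure IsOperatorAction (G : SimpleGraph V) (Y : V → V → (H →ₗ[ℂ] H) →ₗ[ℂ] (H →ₗ[ℂ] H)) :
    Prop where
  map_comp : ∀ x y k l, Y x y (k ∘ₗ l) = ∑ z, Y z y k ∘ₗ Y x z l
  map_id : ∀ x y, Y x y LinearMap.id = if x = y then LinearMap.id else 0
  column : ∀ x y z k, Y z y (Y x y k) = if z = x then Y x y k else 0
  sum_column : ∀ y k, ∑ x, Y x y k = k
  sum_row : ∀ x z k, ∑ y, Y y x (Y y z k) = if x = z then k else 0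
  map_adjoint : ∀ x y k, LinearMap.adjoint (Y x y k) = Y y x (LinearMap.adjoint k)
  adjacency_comm : ∀ x y k, ∑ z, adjacency G y z • Y x z k = ∑ z, adjacency G z x • Y z y k

variable {G : SimpleGraph V} {Y : V → V → (H →ₗ[ℂ] H) →ₗ[ℂ] (H →ₗ[ℂ] H)}

/-- The families of operators that intertwine the action with multiplication. -/
def intertwiners (Y : V → V → (H →ₗ[ℂ] H) →ₗ[ℂ] (H →ₗ[ℂ] H)) : Submodule ℂ (V → H →ₗ[ℂ] H) where
  carrier := {S | ∀ y k, S y ∘ₗ k = ∑ x, Y x y k ∘ₗ S x}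
  add_mem' {S S'} h h' y k := by
    simp only [Pi.add_apply, LinearMap.add_comp, LinearMap.comp_add, Finset.sum_add_distrib, h y k,
      h' y k]
  zero_mem' y k := by simp
  smul_mem' c {S} h y k := by
    simp only [Pi.smul_apply, LinearMap.smul_comp, LinearMap.comp_smul, h y k, Finset.smul_sum]

/-- A finite-dimensional space with an injection into a Hilbert space is isometric to a Hilbert
space in any universe. -/
theorem exists_isometric_model {W F : Type*} [AddCommGroup W] [Module ℂ W]
    [FiniteDimensional ℂ W] [NormedAddCommGroup F] [InnerProductSpace ℂ F] (Φ : W →ₗ[ℂ] F)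
    (hΦ : Function.Injective Φ) :
    ∃ T : EuclideanSpace ℂ (ULift.{w} (Fin (Module.finrank ℂ W))) ≃ₗ[ℂ] W,
      ∀ a b, inner ℂ (Φ (T a)) (Φ (T b)) = inner ℂ a b := by
  let R := LinearMap.range Φ
  let e := LinearEquiv.ofInjective Φ hΦ
  have : Module.finrank ℂ R = Module.finrank ℂ W := e.finrank_eq.symm
  let b : OrthonormalBasis (ULift.{w} (Fin (Module.finrank ℂ W))) ℂ R :=
    ((stdOrthonormalBasis ℂ R).reindex (finCongr this)).reindex Equiv.ulift.symm
  refine ⟨b.repr.symm.toLinearEquiv.trans e.symm, fun a c => ?_⟩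
  have h1 : ∀ r : R, Φ (e.symm r) = r := fun r => congrArg Subtype.val (e.apply_symm_apply r)
  simp only [LinearEquiv.trans_apply, h1]
  rw [← b.repr.symm.inner_map_map a c]
  rfl

namespace IsOperatorAction

variable (h : IsOperatorAction G Y)
include h

/-- Moving k past S' and then S produces Y_zx(Y_yx(k))-type terms within one column; orthogonality
of the column kills those off the diagonal. -/
theorem comp_mem {S S' : V → H →ₗ[ℂ] H} (hS : S ∈ intertwiners Y) (hS' : S' ∈ intertwiners Y) :
    (fun x => S x ∘ₗ S' x) ∈ intertwiners Y := by
  intro y k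
  rw [LinearMap.comp_assoc, hS' y k, linearMap_comp_sum]
  refine Finset.sum_congr rfl fun x _ => ?_
  rw [← LinearMap.comp_assoc, hS, sum_linearMap_comp, Finset.sum_eq_single x]
  · rw [h.column, if_pos rfl, LinearMap.comp_assoc]
  · intro z _ hz
    rw [h.column, if_neg hz, LinearMap.zero_comp, LinearMap.zero_comp]
  · simp

theorem id_mem : (fun _ => LinearMap.id) ∈ intertwiners Y := by
  intro y k
  simp only [LinearMap.id_comp, LinearMap.comp_id, h.sum_column]

theorem comp_adjoint {S : V → H →ₗ[ℂ] H} (hS : S ∈ intertwiners Y) (y : V) (k : H →ₗ[ℂ] H) :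
    k ∘ₗ LinearMap.adjoint (S y) = ∑ x, LinearMap.adjoint (S x) ∘ₗ Y y x k := by
  have := congrArg LinearMap.adjoint (hS y (LinearMap.adjoint k))
  simpa only [LinearMap.adjoint_comp, LinearMap.adjoint_adjoint, map_sum, h.map_adjoint]
    using this

/-- The adjoint relation has the indices of Y exchanged; the row relation Σ_x Y_xw(Y_xz(k)) = δ_wz k
inverts it. -/
theorem adjoint_mem {S : V → H →ₗ[ℂ] H} (hS : S ∈ intertwiners Y) :
    (fun x => LinearMap.adjoint (S x)) ∈ intertwiners Y := by
  intro z k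
  simp only [h.comp_adjoint hS]
  rw [Finset.sum_comm]
  simp only [← linearMap_comp_sum, h.sum_row]
  rw [Finset.sum_eq_single z] <;> simp +contextual

theorem adjacency_mem {S : V → H →ₗ[ℂ] H} (hS : S ∈ intertwiners Y) :
    (fun x => ∑ y, adjacency G x y • S y) ∈ intertwiners Y := by
  intro y k
  have h1 : ∀ z, S z ∘ₗ k = ∑ x, Y x z k ∘ₗ S x := fun z => hS z k
  simp only [sum_linearMap_comp, linearMap_comp_sum, LinearMap.smul_comp, LinearMap.comp_smul, h1,
    Finset.smul_sum]
  rw [Finset.sum_comm, Finset.sum_comm (f := fun x z => adjacency G x z • Y x y k ∘ₗ S z)]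
  refine Finset.sum_congr rfl fun x _ => ?_
  simp only [← LinearMap.smul_comp, ← sum_linearMap_comp, h.adjacency_comm]

/-- Σ_x S_x† S'_x is the composite of an intertwiner H → ℂ^V ⊗ H with the adjoint of another, so it
commutes with End(H). -/
theorem sum_adjoint_comp_comm {S S' : V → H →ₗ[ℂ] H} (hS : S ∈ intertwiners Y)
    (hS' : S' ∈ intertwiners Y) (k : H →ₗ[ℂ] H) :
    (∑ x, LinearMap.adjoint (S x) ∘ₗ S' x) ∘ₗ k = k ∘ₗ ∑ x, LinearMap.adjoint (S x) ∘ₗ S' x := by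
  have h2 : ∀ y, S' y ∘ₗ k = ∑ x, Y x y k ∘ₗ S' x := fun y => hS' y k
  simp only [sum_linearMap_comp, linearMap_comp_sum, LinearMap.comp_assoc, h2]
  simp only [← LinearMap.comp_assoc, h.comp_adjoint hS, sum_linearMap_comp]
  rw [Finset.sum_comm]

/-- Schur's lemma by hand: commuting with |u⟩⟨v| and applying both sides to the unit vector v yields
the scalar. -/
theorem sum_adjoint_comp {v : H} (hv : inner ℂ v v = (1 : ℂ)) {S S' : V → H →ₗ[ℂ] H}
    (hS : S ∈ intertwiners Y) (hS' : S' ∈ intertwiners Y) :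
    ∑ x, LinearMap.adjoint (S x) ∘ₗ S' x = (∑ x, inner ℂ (S x v) (S' x v)) • LinearMap.id := by
  ext u
  have := LinearMap.congr_fun (h.sum_adjoint_comp_comm hS hS' (ketBra u v)) v
  simp only [LinearMap.comp_apply, ketBra_apply, hv, one_smul] at this
  rw [this, LinearMap.sum_apply, inner_sum]
  simp [LinearMap.adjoint_inner_right]

theorem exists_map_eq {A : Type*} [NormedAddCommGroup A] [InnerProductSpace ℂ A]
    [FiniteDimensional ℂ A] {T : V → A →ₗ[ℂ] H →ₗ[ℂ] H}
    (hTs : ∀ S ∈ intertwiners Y, ∃ a, ∀ x, T x a = S x) (y : V) (u : H) :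
    ∃ m, ofOp T m = EuclideanSpace.single y (1 : ℂ) ⊗ₜ[ℂ] u := by
  let e := stdOrthonormalBasis ℂ H
  let B : H → H →ₗ[ℂ] H →ₗ[ℂ] H := fun r =>
    { toFun := fun l => ketBra l r
      map_add' := fun l m => by ext; simp
      map_smul' := fun c l => LinearMap.ext fun w => smul_comm _ _ _ }
  -- The family S_x(l) = Y_yx(|l⟩⟨r|) u: in the representation k ↦ (Y_xz(k)) on ℂ^V ⊗ H, the
  -- operator |l⟩⟨r| applied to |y⟩ ⊗ u. It intertwines because k|l⟩⟨r| = |kl⟩⟨r|. Summing over r =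
  -- l = e_i gives the identity operator, which returns |y⟩ ⊗ u.
  let S : H → V → H →ₗ[ℂ] H := fun r x => (Y y x ∘ₗ B r).flip u
  have hS : ∀ r, S r ∈ intertwiners Y := by
    intro r z k
    ext l
    have h1 : ketBra (k l) r = k ∘ₗ ketBra l r := by ext; simp
    have h2 : S r z (k l) = Y y z (ketBra (k l) r) u := rfl
    have h3 : ∀ x, S r x l = Y y x (ketBra l r) u := fun x => rfl
    rw [LinearMap.comp_apply, h2, h1, h.map_comp, LinearMap.sum_apply, LinearMap.sum_apply]
    simp only [LinearMap.comp_apply, h3]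
  choose a ha using fun r => hTs _ (hS r)
  refine ⟨∑ i, e i ⊗ₜ[ℂ] a (e i), coord_ext fun x => ?_⟩
  have h1 : ∑ i, ketBra (e i) (e i) = LinearMap.id := by
    ext l
    rw [LinearMap.sum_apply]
    exact e.sum_repr' l
  have h2 : ∑ i, Y y x (ketBra (e i) (e i)) u = (if y = x then u else 0) := by
    rw [← LinearMap.sum_apply, ← map_sum, h1, h.map_id]
    split_ifs <;> rfl
  simp only [map_sum, ← op_apply, op_ofOp, ha]
  refine h2.trans ?_
  by_cases hxy : y = x
  · simp [hxy]
  · simp [hxy, Ne.symm hxy]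

/-- P is isometric by `hinner` and reaches every |x⟩ ⊗ u by `exists_map_eq`, so PP† = 1; the claim
is this identity in entries. -/
theorem sum_comp_adjoint {A : Type*} [NormedAddCommGroup A] [InnerProductSpace ℂ A]
    [FiniteDimensional ℂ A] {T : V → A →ₗ[ℂ] H →ₗ[ℂ] H}
    (hinner : ∀ a b, ∑ x, LinearMap.adjoint (T x a) ∘ₗ T x b = inner ℂ a b • LinearMap.id)
    (hTs : ∀ S ∈ intertwiners Y, ∃ a, ∀ x, T x a = S x) (x y : V) :
    ∑ j, T y (stdOrthonormalBasis ℂ A j) ∘ₗ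
      LinearMap.adjoint (T x (stdOrthonormalBasis ℂ A j)) = if x = y then LinearMap.id else 0 := by
  let P := ofOp T
  have hiso : LinearMap.adjoint P ∘ₗ P = LinearMap.id := by
    refine TensorProduct.ext' fun u a => (TensorProduct.ext_iff_inner_left (𝕜 := ℂ)).2 fun l b => ?_
    rw [LinearMap.comp_apply, LinearMap.adjoint_inner_right, inner_eq_sum_coord]
    simp only [← op_apply, P, op_ofOp, LinearMap.id_apply, TensorProduct.inner_tmul]
    have := congrArg (inner ℂ l) (LinearMap.congr_fun (hinner b a) u)
    simpa [LinearMap.sum_apply, inner_sum, LinearMap.adjoint_inner_right, inner_smul_right,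
      mul_comm] using this
  ext u
  have h1 : P (LinearMap.adjoint P (EuclideanSpace.single x (1 : ℂ) ⊗ₜ[ℂ] u)) =
      EuclideanSpace.single x (1 : ℂ) ⊗ₜ[ℂ] u := by
    obtain ⟨m, hm⟩ := h.exists_map_eq hTs x u
    rw [← hm]
    exact congrArg P (LinearMap.congr_fun hiso m)
  have h2 := congrArg (coord y) h1
  rw [adjoint_single P (stdOrthonormalBasis ℂ A), map_sum, map_sum] at h2
  simp only [← op_apply, P, op_ofOp, coord_tmul] at h2
  rw [LinearMap.sum_apply]
  refine h2.trans ?_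
  by_cases hxy : x = y
  · simp [hxy]
  · simp [hxy, Ne.symm hxy]

theorem exists_isOperatorAlgebra [Nontrivial H] :
    ∃ T : V → EuclideanSpace ℂ (ULift.{w} (Fin (Module.finrank ℂ (intertwiners Y)))) →ₗ[ℂ]
      H →ₗ[ℂ] H, IsOperatorAlgebra G T ∧
        ∀ a y k, T y a ∘ₗ k = ∑ x, Y x y k ∘ₗ T x a := by
  obtain ⟨v₀, hv₀⟩ := exists_ne (0 : H)
  obtain ⟨v, hv⟩ : ∃ v : H, inner ℂ v v = (1 : ℂ) := by
    refine ⟨((‖v₀‖⁻¹ : ℝ) : ℂ) • v₀, ?_⟩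
    rw [inner_self_eq_norm_sq_to_K, norm_smul]
    simp [hv₀]
  -- Evaluation at v is injective since S_y u = S_y |u⟩⟨v| v = Σ_x Y_xy(|u⟩⟨v|) S_x v. The inner
  -- product pulled back from it is the scalar given by Schur's lemma.
  let Φ : intertwiners Y →ₗ[ℂ] PiLp 2 (fun _ : V => H) :=
    { toFun := fun S => WithLp.toLp 2 fun x => S.1 x v
      map_add' := fun S S' => by ext x; simp
      map_smul' := fun c S => by ext x; simp }
  have hΦ : Function.Injective Φ := by
    rw [← LinearMap.ker_eq_bot, LinearMap.ker_eq_bot']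
    intro S hS
    have h1 : ∀ x, S.1 x v = 0 := fun x => congrFun (congrArg WithLp.ofLp hS) x
    ext y u
    have := LinearMap.congr_fun (S.2 y (ketBra u v)) v
    have hv0 : v ≠ 0 := by
      rintro rfl
      simp at hv
    simpa [hv, h1, LinearMap.sum_apply, hv0] using this
  obtain ⟨T₀, hT₀⟩ := exists_isometric_model.{w} Φ hΦ
  let T : V → EuclideanSpace ℂ (ULift.{w} (Fin (Module.finrank ℂ (intertwiners Y)))) →ₗ[ℂ]
      H →ₗ[ℂ] H := fun x => LinearMap.proj x ∘ₗ (intertwiners Y).subtype ∘ₗ T₀.toLinearMap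
  have hT : ∀ a, (fun x => T x a) ∈ intertwiners Y := fun a => (T₀ a).2
  have hTs : ∀ S ∈ intertwiners Y, ∃ a, ∀ x, T x a = S x := fun S hS =>
    ⟨T₀.symm ⟨S, hS⟩, fun x => by simp [T]⟩
  have hinner : ∀ a b, ∑ x, LinearMap.adjoint (T x a) ∘ₗ T x b = inner ℂ a b • LinearMap.id := by
    intro a b
    rw [h.sum_adjoint_comp hv (hT a) (hT b), ← hT₀, PiLp.inner_apply]
    rfl
  refine ⟨T, ⟨hinner, h.sum_comp_adjoint hinner hTs, fun a b => hTs _ (h.comp_mem (hT b) (hT a)),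
    hTs _ h.id_mem, fun a => hTs _ (h.adjoint_mem (hT a)), fun a => hTs _ (h.adjacency_mem (hT a))⟩,
    fun a => hT a⟩

end IsOperatorAction
end Action

/-! ## Splitting simple Frobenius monoids -/

section FrobeniusMonoid

variable {V : Type*} [Fintype V] [DecidableEq V] {G : SimpleGraph V}
  {K A : Type*} [NormedAddCommGroup K] [InnerProductSpace ℂ K] [FiniteDimensional ℂ K]
  [NormedAddCommGroup A] [InnerProductSpace ℂ A] [FiniteDimensional ℂ A]
  {H : Type*} [NormedAddCommGroup H] [InnerProductSpace ℂ H] [FiniteDimensional ℂ H]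
  {E : Type*} [NormedAddCommGroup E] [InnerProductSpace ℂ E] [FiniteDimensional ℂ E]

theorem IsEndModel.exists_of_isStarIso [Nontrivial H] {N : MonoidData E}
    {τ : E ≃ₗ[ℂ] (H →ₗ[ℂ] H)} (h : IsEndModel N τ) {M : MonoidData K} (hM : M.IsRightFrobenius)
    {f : K →ₗ[ℂ] E} (hf : M.IsStarIso N f) :
    ∃ φ : K ≃ₗ[ℂ] (H →ₗ[ℂ] H), (∀ k, φ k = τ (f k)) ∧ IsEndModel M φ := by
  let g : K ≃ₗ[ℂ] E := LinearEquiv.ofLinearMap f (LinearMap.adjoint f)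
    (hf.comp_adjoint h.isRightFrobenius) (hf.adjoint_comp hM)
  refine ⟨g.trans τ, fun k => rfl, fun k l => ?_, ?_, fun k l => ?_⟩
  · have := LinearMap.congr_fun hf.1.map_mul (k ⊗ₜ l)
    simp only [LinearMap.comp_apply, TensorProduct.map_tmul] at this
    exact (congrArg τ this).trans (h.map_mul _ _)
  · have : f M.one = N.one := LinearMap.congr_fun hf.1.map_unit 1
    exact (congrArg τ this).trans h.map_one
  · refine Eq.trans ?_ (h.inner_eq (f k) (f l))
    rw [← LinearMap.adjoint_inner_right, ← LinearMap.comp_apply, hf.adjoint_comp hM,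
      LinearMap.id_apply]

theorem setAlgebra_sharp_single (x : V) :
    (setAlgebra V).sharp (EuclideanSpace.single x (1 : ℂ)) = EuclideanSpace.single x 1 := by
  have h : innerₛₗ ℂ (EuclideanSpace.single x (1 : ℂ) : EuclideanSpace ℂ V) =
      (setAlgebra V).counit ∘ₗ (setAlgebra V).mulRight (EuclideanSpace.single x 1) :=
    set_ext fun v => by
      by_cases hv : v = x
      · simp [MonoidData.mulRight, setAlgebra_mul_single, setAlgebra_counit_single, hv]
      · simp [MonoidData.mulRight, setAlgebra_mul_single, hv, EuclideanSpace.inner_single_left,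
          Ne.symm hv]
  refine ext_inner_right ℂ fun w => ?_
  rw [MonoidData.inner_sharp, ← MonoidData.counit_apply]
  exact (LinearMap.congr_fun h w).symm

theorem coord_assoc_tmul (y : V) (u : EuclideanSpace ℂ V ⊗[ℂ] K) (m : A) :
    coord y (TensorProduct.assoc ℂ (EuclideanSpace ℂ V) K A (u ⊗ₜ m)) = coord y u ⊗ₜ m := by
  induction u with
  | zero => simp
  | add u v hu hv => simp only [TensorProduct.add_tmul, map_add, hu, hv]
  | tmul v k => simp [TensorProduct.smul_tmul']

theorem op_compCross_tmul (P Q : K ⊗[ℂ] EuclideanSpace ℂ V →ₗ[ℂ] EuclideanSpace ℂ V ⊗[ℂ] K) (y : V)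
    (a : EuclideanSpace ℂ V) (k l : K) :
    op (compCross Q P) y a (k ⊗ₜ l) =
      ∑ z, op Q y (EuclideanSpace.single z 1) k ⊗ₜ[ℂ] op P z a l := by
  rw [op_apply]
  simp only [compCross, LinearMap.comp_apply, LinearEquiv.coe_coe,
    TensorProduct.assoc_tmul, LinearMap.lTensor_tmul, map_tmul_eq P,
    TensorProduct.tmul_sum, map_sum, TensorProduct.assoc_symm_tmul, LinearMap.rTensor_tmul,
    coord_assoc_tmul]
  rfl

theorem isIntertwiner_of_single {P : K ⊗[ℂ] EuclideanSpace ℂ V →ₗ[ℂ] EuclideanSpace ℂ V ⊗[ℂ] K}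
    {Q : E ⊗[ℂ] EuclideanSpace ℂ V →ₗ[ℂ] EuclideanSpace ℂ V ⊗[ℂ] E} {g : K →ₗ[ℂ] E}
    (h : ∀ x y k, op Q y (EuclideanSpace.single x 1) (g k) =
      g (op P y (EuclideanSpace.single x 1) k)) : IsIntertwiner P Q g := by
  refine TensorProduct.ext (LinearMap.ext fun k => set_ext fun x => coord_ext fun y => ?_)
  have := h x y k
  simpa [coord_lTensor, ← op_apply] using this

/-! ### The projective permutation matrix of X -/

namespace QuantumIso

variable (X : QuantumIso (classicalGraph G) (classicalGraph G) K)

theorem entry_comp_entry (x y z : V) :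
    entry X z y ∘ₗ entry X x y = if z = x then entry X x y else 0 := by
  have := X.op_mul y (EuclideanSpace.single x 1) (EuclideanSpace.single z 1)
  rw [setAlgebra_mul_single] at this
  rw [entry_eq_op, entry_eq_op, ← this]
  by_cases h : z = x
  · simp [h]
  · simp [h, Ne.symm h]

theorem sum_entry_left (y : V) : ∑ x, entry X x y = LinearMap.id := by
  have := X.op_one y
  rw [MonoidData.one, setAlgebra_unit_apply, map_sum] at this
  exact this

theorem adjoint_entry (x y : V) : LinearMap.adjoint (entry X x y) = entry X x y := by
  rw [entry_eq_op]
  exact (X.adjoint_op y _).trans (by rw [setAlgebra_sharp_single])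

theorem entry_comp_entry_row (x y z : V) :
    entry X z y ∘ₗ entry X z x = if x = y then entry X z x else 0 := by
  have h := (comul_iff X.P setAlgebra_isDaggerFrobenius.isRightFrobenius
    (EuclideanSpace.basisFun V ℂ)).1 X.comul x y (EuclideanSpace.single z 1)
  simp only [EuclideanSpace.basisFun_apply, setAlgebra_sharp_single, setAlgebra_mul_single] at h
  rw [entry_eq_op, entry_eq_op, ← h, Finset.sum_eq_single z]
  · simp
  · intro w _ hw
    simp [Ne.symm hw]
  · simp

theorem sum_entry_comp (x z : V) :
    ∑ y, entry X y x ∘ₗ entry X y z = if x = z then LinearMap.id else 0 := by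
  simp only [entry_comp_entry_row]
  by_cases h : x = z
  · simp [h, sum_entry_left]
  · simp [h, Ne.symm h]

theorem adjacency_entry (x y : V) :
    ∑ z, adjacency G y z • entry X x z = ∑ z, adjacency G z x • entry X z y := by
  have := X.op_adj y (EuclideanSpace.single x 1)
  rw [adjacency_single, map_sum] at this
  simp only [map_smul] at this
  exact this.symm

end QuantumIso

variable {X : QuantumIso (classicalGraph G) (classicalGraph G) K} {M : MonoidData K}
  (hX : IsFrobeniusMonoid X M)

namespace IsFrobeniusMonoid
include hX

theorem entry_mul (x y : V) (k l : K) : entry X x y (M.mul (k ⊗ₜ l)) =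
    ∑ z, M.mul (entry X z y k ⊗ₜ entry X x z l) := by
  have := (isIntertwiner_iff_op _ _ _).1 hX.mul_intertwiner y (EuclideanSpace.single x 1)
  have h2 := LinearMap.congr_fun this (k ⊗ₜ l)
  rw [LinearMap.comp_apply, LinearMap.comp_apply, op_compCross_tmul, map_sum] at h2
  exact h2

theorem entry_one (x y : V) : entry X x y M.one = if x = y then M.one else 0 := by
  have := congrArg (coord y)
    (LinearMap.congr_fun hX.unit_intertwiner ((1 : ℂ) ⊗ₜ EuclideanSpace.single x (1 : ℂ)))
  have h2 : entry X x y M.one =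
      (EuclideanSpace.single x (1 : ℂ) : EuclideanSpace ℂ V) y • M.one := by
    refine this.trans ?_
    simp [unitCross, MonoidData.one]
  rw [h2]
  by_cases h : x = y
  · simp [h]
  · simp [h, Ne.symm h]

/-- The entries are self-adjoint, so compatibility with the unit passes to the counit. -/
theorem inner_one_entry (x y : V) (k : K) :
    inner ℂ M.one (entry X x y k) = if x = y then inner ℂ M.one k else 0 := by
  rw [← X.adjoint_entry, LinearMap.adjoint_inner_right, hX.entry_one]
  split_ifs <;> simp

/-- Passing to ♯ transposes the indices; on operators this is Y_xy(k)† = Y_yx(k†), which makes the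
representation of End(H) a `*`-representation. -/
theorem sharp_entry (w y : V) (k : K) : M.sharp (entry X y w k) = entry X w y (M.sharp k) := by
  refine ext_inner_right ℂ fun l => ?_
  rw [← X.adjoint_entry w y, LinearMap.adjoint_inner_left, MonoidData.inner_sharp,
    MonoidData.inner_sharp]
  -- The sum Σ_x ε(X_xy(l · X_xw(k))) is computed twice: counitality leaves ε(l · X_yw(k)), while
  -- multiplicativity and Σ_x X_xz X_xw = δ_zw leave ε(X_wy(l) · k).
  have h1 : ∀ x, (if x = y then inner ℂ M.one (M.mul (l ⊗ₜ entry X x w k)) else 0) =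
      ∑ z, inner ℂ M.one (M.mul (entry X z y l ⊗ₜ entry X x z (entry X x w k))) := fun x => by
    rw [← hX.inner_one_entry, hX.entry_mul, inner_sum]
  have h2 := Finset.sum_congr rfl fun x (_ : x ∈ Finset.univ) => h1 x
  have h3 : ∀ z, ∑ x, entry X x z (entry X x w k) = if z = w then k else 0 := fun z => by
    have := LinearMap.congr_fun (X.sum_entry_comp z w) k
    rw [LinearMap.sum_apply] at this
    refine this.trans ?_
    split_ifs <;> rfl
  rw [Finset.sum_ite_eq' Finset.univ y, if_pos (Finset.mem_univ y), Finset.sum_comm] at h2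
  simp only [← inner_sum, ← map_sum, ← TensorProduct.tmul_sum, h3] at h2
  refine h2.trans ?_
  rw [Finset.sum_eq_single w]
  · simp
  · intro z _ hz
    simp [hz]
  · simp

/-- The quantum automorphism induced on the operators of `H`. -/
theorem isOperatorAction [Nontrivial H] {φ : K ≃ₗ[ℂ] (H →ₗ[ℂ] H)} (h : IsEndModel M φ) :
    IsOperatorAction G fun x y => φ.toLinearMap ∘ₗ entry X x y ∘ₗ φ.symm.toLinearMap where
  map_comp x y k l := by
    have h1 : ∀ a b : K, φ a ∘ₗ φ b =
        ((√(Module.finrank ℂ H : ℝ) : ℝ) : ℂ) • φ (M.mul (a ⊗ₜ b)) := fun a b => by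
      rw [h.map_mul, smul_smul, mul_comm, one_div_sqrt_mul_sqrt, one_smul]
    obtain ⟨a, rfl⟩ := φ.surjective k
    obtain ⟨b, rfl⟩ := φ.surjective l
    simp only [LinearMap.comp_apply, LinearEquiv.coe_coe, φ.symm_apply_apply, h1, map_smul,
      hX.entry_mul, map_sum, Finset.smul_sum]
  map_id x y := by
    have h1 : φ.symm LinearMap.id =
        ((1 / √(Module.finrank ℂ H : ℝ) : ℝ) : ℂ) • M.one := by
      rw [LinearEquiv.symm_apply_eq, map_smul, h.map_one, smul_smul, one_div_sqrt_mul_sqrt,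
        one_smul]
    have h2 := congrArg φ (hX.entry_one x y)
    simp only [LinearMap.comp_apply, LinearEquiv.coe_coe, h1, map_smul, h2]
    split_ifs
    · rw [h.map_one, smul_smul, one_div_sqrt_mul_sqrt, one_smul]
    · simp
  column x y z k := by
    have := LinearMap.congr_fun (X.entry_comp_entry x y z) (φ.symm k)
    simp only [LinearMap.comp_apply, LinearEquiv.coe_coe, φ.symm_apply_apply] at this ⊢
    rw [this]
    split_ifs <;> simp
  sum_column y k := by
    have := congrArg φ (LinearMap.congr_fun (X.sum_entry_left y) (φ.symm k))
    simpa [LinearMap.sum_apply] using this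
  sum_row x z k := by
    have := congrArg φ (LinearMap.congr_fun (X.sum_entry_comp x z) (φ.symm k))
    simp only [LinearMap.sum_apply, map_sum, LinearMap.comp_apply] at this
    simp only [LinearMap.comp_apply, LinearEquiv.coe_coe, φ.symm_apply_apply]
    rw [this]
    split_ifs <;> simp
  map_adjoint x y k := by
    obtain ⟨a, rfl⟩ := φ.surjective k
    simp only [LinearMap.comp_apply, LinearEquiv.coe_coe, φ.symm_apply_apply, ← h.map_sharp,
      hX.sharp_entry]
  adjacency_comm x y k := by
    have := congrArg φ (LinearMap.congr_fun (X.adjacency_entry x y) (φ.symm k))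
    simpa only [LinearMap.sum_apply, map_sum, LinearMap.smul_apply, map_smul] using! this

end IsFrobeniusMonoid

theorem exists_splitsAs {K : Type k} [NormedAddCommGroup K] [InnerProductSpace ℂ K]
    [FiniteDimensional ℂ K] {X : QuantumIso (classicalGraph G) (classicalGraph G) K}
    {M : MonoidData K} (hX : IsFrobeniusMonoid X M)
    {H : Type v} [NormedAddCommGroup H] [InnerProductSpace ℂ H] [FiniteDimensional ℂ H]
    [Nontrivial H] {f : K →ₗ[ℂ] H ⊗[ℂ] StrongDual ℂ H}
    (hf : MonoidData.IsStarIso (B := H ⊗[ℂ] StrongDual ℂ H) M (endAlgebra H) f) :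
    ∃ (Γ : QuantumGraph.{w}) (P : QuantumIso Γ (classicalGraph G) H), SplitsAs X M P := by
  obtain ⟨φ, hφ, hmodel⟩ := IsEndModel.exists_of_isStarIso (E := H ⊗[ℂ] StrongDual ℂ H)
    (endAlgebra_isEndModel H) hX.frobenius.isRightFrobenius hf
  have hY := hX.isOperatorAction hmodel
  obtain ⟨T, hT, hTY⟩ := hY.exists_isOperatorAlgebra.{w}
  refine ⟨hT.quantumGraph, hT.quantumIso, f, hf, ?_⟩
  refine isIntertwiner_of_single (E := H ⊗[ℂ] StrongDual ℂ H) fun x y l => ?_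
  apply (toEndEquiv H).injective
  refine (hT.toEnd_op_quantumIso x y (f l)).trans (Eq.trans ?_ (hφ (entry X x y l)))
  rw [← hφ]
  -- The intertwining relation moves l to the left of T; summing over the basis then leaves δ_zx,
  -- hence only the entry X_xy(l).
  have h1 : ∀ a, T y a ∘ₗ φ l ∘ₗ LinearMap.adjoint (T x a) =
      ∑ z, φ (entry X z y l) ∘ₗ T z a ∘ₗ LinearMap.adjoint (T x a) := fun a => by
    rw [← LinearMap.comp_assoc, hTY, sum_linearMap_comp]
    simp only [LinearMap.comp_apply, LinearEquiv.coe_coe, φ.symm_apply_apply, LinearMap.comp_assoc]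
  simp only [h1]
  rw [Finset.sum_comm]
  simp only [← linearMap_comp_sum, hT.sum_comp_adjoint]
  rw [Finset.sum_eq_single x]
  · simp
  · intro z _ hz
    simp [Ne.symm hz]
  · simp

end FrobeniusMonoid

end

end QGraph

theorem mainTheorem4 {V : Type u} [Fintype V] [DecidableEq V]
    (G : SimpleGraph V)
    {K : Type k} [NormedAddCommGroup K] [InnerProductSpace ℂ K] [FiniteDimensional ℂ K]
    (X : QGraph.QuantumIso (QGraph.classicalGraph G) (QGraph.classicalGraph G) K)
    (M : QGraph.MonoidData K) (hX : QGraph.IsFrobeniusMonoid X M)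
    {H : Type v} [NormedAddCommGroup H] [InnerProductSpace ℂ H] [FiniteDimensional ℂ H]
    [Nontrivial H]
    (f : K →ₗ[ℂ] H ⊗[ℂ] StrongDual ℂ H)
    (hf : QGraph.MonoidData.IsStarIso (B := H ⊗[ℂ] StrongDual ℂ H) M (QGraph.endAlgebra H) f)
    {ι : Type i} [Fintype ι] (e : OrthonormalBasis ι ℂ H) :
    (∃ (ΓX : QGraph.QuantumGraph.{w}) (P : QGraph.QuantumIso ΓX (QGraph.classicalGraph G) H),
      QGraph.SplitsAs X M P) ∧
    ∀ (ΓX : QGraph.QuantumGraph.{w}) (L : Type z) [NormedAddCommGroup L]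
      [InnerProductSpace ℂ L] [FiniteDimensional ℂ L]
      (P : QGraph.QuantumIso ΓX (QGraph.classicalGraph G) L), QGraph.SplitsAs X M P →
      (Module.finrank ℂ ΓX.alg.center : ℂ) =
        1 / (Module.finrank ℂ H : ℂ) * ∑ x : V,
          QGraph.network e (QGraph.diagonal X f x) (QGraph.diagonal X f x) ∧
      (ΓX.IsClassical ↔ Module.finrank ℂ ΓX.alg.center = Fintype.card V) ∧
      (ΓX.IsClassical ↔
        1 / (Module.finrank ℂ H : ℂ) * ∑ x : V,
          QGraph.network e (QGraph.diagonal X f x) (QGraph.diagonal X f x) = Fintype.card V) := by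
  refine ⟨QGraph.exists_splitsAs hX hf, fun ΓX L _ _ _ P hP => ?_⟩
  -- Nontriviality of L is obtained along with the formula, since the count dim V_Γ = |V| fails to
  -- follow when L = 0.
  obtain ⟨hL, hdim⟩ := QGraph.finrank_center_eq hX.frobenius.isRightFrobenius hf e hP
  refine ⟨hdim, P.isClassical_iff, ?_⟩
  rw [← hdim, P.isClassical_iff]
  exact Nat.cast_inj.symm
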